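/- **Definitions.** Graphs are finite and may have loops and parallel edges. A (finite) *2-complex* $C=(V,E,F)$ is a graph $(V,E)$, each of whose edges has a fixed direction, together with a finite family $F$ of non-empty closed trails (closed walks traversing no edge twice), called *faces*, such that every vertex and every edge lies on a face. The *link graph* $L(v)$ at a vertex $v$ has one vertex for each non-loop edge incident with $v$ and two vertices for each loop at $v$ (one for each end of the loop), and one edge for each traversal of a face at $v$, joining the end of the edge through which the face enters $v$ to the end of the edge through which it leaves $v$. A graph is *3-connected* if it has at least four vertices, has no loops and no parallel edges, and deleting fewer than three vertices never disconnects it; $C$ is *locally 3-connected* if all its link graphs are 3-connected. A *rotation system* of a graph assigns to each vertex a cyclic orientation (its *rotator*) of the edges incident with it; it is *planar* if the oriented surface obtained by gluing discs along the facial walks it determines is a disjoint union of 2-spheres. A *rotation system of $C$* is a family $(\sigma_e\mid e\in E)$ of cyclic orientations $\sigma_e$ of the faces incident with $e$. It induces a rotation system of each $L(v)$: the rotator at a vertex of $L(v)$ given by an end of $e$ at $v$ is $\sigma_e$ if $e$ is directed towards $v$ at that end, and the reverse of $\sigma_e$ otherwise. It is *planar* if all induced rotation systems of link graphs are planar. A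 link graph $L(v)$ is *loop-planar* if it has a planar rotation system such that for every loop $\ell$ at $v$ the rotators at the two vertices of $L(v)$ associated with $\ell$ are reverse to each other, where an edge of $L(v)$ at one of them corresponds to the edge at the other that comes from the same face. $C$ is *locally planar* if all its link graphs are loop-planar. For a non-loop edge $x$, the 2-complex $C/x$ arises by identifying the endvertices of $x$ and deleting $x$ from the graph and from all faces; a *contraction* of $C$ is any 2-complex obtained by successively contracting zero or more edges, each of which is not a loop when it is contracted. **Lemma 2.3.** A locally 3-connected 2-complex has a planar rotation system if and only if all of its contractions (including the 2-complex itself) are locally planar. -/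

import Mathlib

universe u v

/-- A (directed) graph with vertex set `V` and edge set `E`, loops and parallel edges allowed.
The edge `e` has two half-edges: `(e, false)` at its starting vertex and `(e, true)` at its
endvertex, and `endpoint` gives the vertex at which a half-edge is attached. -/
structure Multigraph (V : Type u) (E : Type v) where
  endpoint : E × Bool → V

/-- The other half of the edge to which a half-edge belongs. -/
def halfFlip {E : Type v} : Equiv.Perm (E × Bool) :=
  Equiv.prodCongr (Equiv.refl E) Equiv.boolNot

namespace Multigraph

variable {V : Type u} {E : Type v} (G : Multigraph V E)

/-- `e` is a loop. -/
def IsLoop (e : E) : Prop := G.endpoint (e, false) = G.endpoint (e, true)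

/-- `a` and `b` are joined by an edge. -/
def Adj (a b : V) : Prop := ∃ h : E × Bool, G.endpoint h = a ∧ G.endpoint (halfFlip h) = b

/-- The vertex set of the connected component of `a`. -/
def component (a : V) : Set V := {b | Relation.ReflTransGen G.Adj a b}

/-- A graph is 3-connected if it has at least four vertices, no loops, no parallel edges, and
deleting fewer than three vertices never leaves two vertices that no path joins. -/
structure ThreeConnected : Prop where
  four_le_card : 4 ≤ Nat.card V
  not_isLoop : ∀ e, ¬ G.IsLoop e
  no_parallel : ∀ h k : E × Bool, G.endpoint h = G.endpoint k →
    G.endpoint (halfFlip h) = G.endpoint (halfFlip k) → h.1 = k.1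
  connected_delete : ∀ X : Finset V, X.card < 3 → ∀ a b : V, a ∉ X → b ∉ X →
    Relation.ReflTransGen (fun c d => G.Adj c d ∧ c ∉ X ∧ d ∉ X) a b

/-- A dart is a directed edge; it is written as the half-edge at which it ends, so the dart `d`
goes from `endpoint (halfFlip d)` to `endpoint d`. `IsWalk a l b` says that the list `l` of darts
is a walk from `a` to `b`. -/
def IsWalk : V → List (E × Bool) → V → Prop
  | a, [], b => a = b
  | a, d :: l, b => G.endpoint (halfFlip d) = a ∧ IsWalk (G.endpoint d) l b

/-- A rotation system of `G`. The rotators (cyclic orientations of the edges incident with a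
vertex, a loop being counted once for each of its halves) are the cycles of one permutation
`next` of the half-edges: its cycles are exactly the sets of half-edges at a common vertex. -/
structure RotationSystem where
  next : Equiv.Perm (E × Bool)
  sameCycle_iff : ∀ h k, next.SameCycle h k ↔ G.endpoint h = G.endpoint k

namespace RotationSystem

variable {G} (R : G.RotationSystem)

/-- Traversal of the boundaries of the faces of the surface defined by a rotation system. Here a
directed edge is written as the half-edge at which it *starts*. The directed edge starting with
`h` is followed by the edge that comes just after it in the rotator at its endvertex. -/
def faceWalk : Equiv.Perm (E × Bool) := halfFlip.trans R.next

/-- The faces (orbits of directed edges under `faceWalk`) whose boundary lies in the set `K` of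
vertices. -/
def facesIn (K : Set V) : Set (Quotient (Equiv.Perm.SameCycle.setoid R.faceWalk)) :=
  (fun h => Quotient.mk (Equiv.Perm.SameCycle.setoid R.faceWalk) h) '' {h | G.endpoint h ∈ K}

/-- A rotation system of a finite graph is planar if the oriented closed surface that arises by
gluing a disc onto each facial walk is a disjoint union of 2-spheres, that is, if each of its
components has Euler characteristic 2 (`|V| + |F| = |E| + 2`). The components of the surface
correspond to the components of the graph that have an edge; isolated vertices impose nothing. -/
def Planar : Prop :=
  ∀ e₀ : E,
    (G.component (G.endpoint (e₀, false))).ncard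
        + (R.facesIn (G.component (G.endpoint (e₀, false)))).ncard
      = {e : E | G.endpoint (e, false) ∈ G.component (G.endpoint (e₀, false))}.ncard + 2

end RotationSystem

theorem IsWalk.append {l m : List (E × Bool)} {a b c : V} :
    G.IsWalk a l b → G.IsWalk b m c → G.IsWalk a (l ++ m) c := by
  induction l generalizing a with
  | nil => intro h h'; cases h; simpa using h'
  | cons d l ih => exact fun h h' => ⟨h.1, ih h.2 h'⟩

theorem IsWalk.split {l m : List (E × Bool)} {a c : V} :
    G.IsWalk a (l ++ m) c → ∃ b, G.IsWalk a l b ∧ G.IsWalk b m c := by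
  induction l generalizing a with
  | nil => intro h; exact ⟨a, rfl, by simpa using h⟩
  | cons d l ih =>
    intro h
    obtain ⟨b, h1, h2⟩ := ih h.2
    exact ⟨b, ⟨h.1, h1⟩, h2⟩

open Classical in
/-- In a closed walk, the cyclic successor of a dart starts where the dart ends. -/
theorem IsWalk.endpoint_formPerm {l : List (E × Bool)} (hl : l.Nodup) {a : V}
    (h : G.IsWalk a l a) {d : E × Bool} (hd : d ∈ l) :
    G.endpoint (halfFlip (l.formPerm d)) = G.endpoint d := by
  obtain ⟨s, t, rfl⟩ := List.append_of_mem hd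
  obtain ⟨b, h1, h2⟩ := IsWalk.split G h
  have h3 : G.IsWalk (G.endpoint d) (t ++ s) b := IsWalk.append G h2.2 h1
  have hrot : (d :: (t ++ s)) ~r (s ++ d :: t) := by
    have := List.IsRotated.symm (List.isRotated_append (l := s) (l' := d :: t))
    simpa using this
  have hnd : (d :: (t ++ s)).Nodup := hrot.nodup_iff.2 hl
  rw [← List.formPerm_eq_of_isRotated hnd hrot]
  cases hts : t ++ s with
  | nil =>
    rw [hts] at h3
    have h4 : G.endpoint d = b := h3
    simp [h2.1, h4]
  | cons y r =>
    rw [hts] at h3 hnd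
    rw [List.formPerm_apply_head d y r hnd]
    exact h3.1

end Multigraph

/-- A finite (directed) 2-complex: a finite graph together with a finite family of closed trails,
its faces, such that every edge and every vertex is incident with a face. A face is given as the
list of the darts that it traverses (a dart being written as the half-edge at which it ends); no
edge is traversed twice. -/
structure TwoComplex where
  V : Type u
  E : Type u
  F : Type u
  finite_V : Finite V
  finite_E : Finite E
  finite_F : Finite F
  graph : Multigraph V E
  face : F → List (E × Bool)
  face_ne_nil : ∀ f, face f ≠ []
  face_nodup : ∀ f, ((face f).map Prod.fst).Nodup
  face_closed : ∀ f, ∃ a, graph.IsWalk a (face f) a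
  edge_incident : ∀ e, ∃ f, e ∈ (face f).map Prod.fst
  vertex_incident : ∀ a, ∃ f, ∃ d ∈ face f, graph.endpoint d = a

namespace TwoComplex

variable (C : TwoComplex.{u})

/-! ### Link graphs -/

open Classical in
/-- The dart that follows the dart `d` on the face `f`, in the cyclic order of the closed trail
(on a face that consists of a single loop, `d` itself). -/
noncomputable def nextDart (f : C.F) (d : C.E × Bool) : C.E × Bool := (C.face f).formPerm d

theorem endpoint_nextDart {f : C.F} {d : C.E × Bool} (hd : d ∈ C.face f) :
    C.graph.endpoint (halfFlip (C.nextDart f d)) = C.graph.endpoint d := by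
  classical
  obtain ⟨a, ha⟩ := C.face_closed f
  have h := Multigraph.IsWalk.endpoint_formPerm C.graph (C.face_nodup f).of_map ha hd
  unfold nextDart
  convert h

/-- The vertices of the link graph at `a`: the half-edges of `C` at `a`. So there is one vertex
for each non-loop edge incident with `a`, and there are two for each loop. -/
abbrev LinkVertex (a : C.V) : Type u := {h : C.E × Bool // C.graph.endpoint h = a}

/-- The edges of the link graph at `a`: the traversals of a face at `a`. The traversal `(f, d)` is
the one at which the face `f` arrives at `a` through the dart `d` and leaves it through the next
dart. -/
abbrev LinkEdge (a : C.V) : Type u :=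
  {p : C.F × (C.E × Bool) // p.2 ∈ C.face p.1 ∧ C.graph.endpoint p.2 = a}

/-- The link graph `L(a)`: the traversal `(f, d)` joins the half-edge through which `f` arrives
and the half-edge through which it leaves. -/
noncomputable def link (a : C.V) : Multigraph (C.LinkVertex a) (C.LinkEdge a) where
  endpoint
    | (p, false) => ⟨p.1.2, p.2.2⟩
    | (p, true) => ⟨halfFlip (C.nextDart p.1.1 p.1.2), (C.endpoint_nextDart p.2.1).trans p.2.2⟩

/-- `C` is locally 3-connected if all its link graphs are 3-connected. -/
def LocallyThreeConnected : Prop := ∀ a, (C.link a).ThreeConnected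

/-! ### Rotation systems -/

/-- The faces incident with an edge. -/
abbrev IncidentFace (e : C.E) : Type u := {f : C.F // e ∈ (C.face f).map Prod.fst}

/-- A rotation system of a 2-complex: for each edge a cyclic orientation of the faces incident
with it, given as a permutation with only one cycle. -/
structure RotationSystem where
  rot : ∀ e, Equiv.Perm (C.IncidentFace e)
  sameCycle : ∀ e f g, (rot e).SameCycle f g

variable {C}

/-- The rotation system `S` of `C` induces the rotation system `R` of the link graph at `a`: if
the edge `e` is directed towards `a`, then the rotator of `R` at the corresponding vertex of the
link graph (the half-edge `(e, true)`) is the rotator of `S` at `e`; otherwise (at the half-edge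
`(e, false)`) it is its reverse. Here an edge of the link graph is identified with the face that it
is a traversal of; for a fixed half-edge of `C` this is a bijection, as a face traverses an edge at
most once. -/
def RotationSystem.Induces (S : C.RotationSystem) {a : C.V} (R : (C.link a).RotationSystem) :
    Prop :=
  ∀ (e : C.E) (f g : C.IncidentFace e) (k : C.LinkEdge a × Bool),
    S.rot e f = g →
      (((C.link a).endpoint k).1 = (e, true) → k.1.1.1 = f.1 → (R.next k).1.1.1 = g.1) ∧
      (((C.link a).endpoint k).1 = (e, false) → k.1.1.1 = g.1 → (R.next k).1.1.1 = f.1)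

/-- A rotation system of `C` is planar if all rotation systems that it induces at the link graphs
are planar. -/
def RotationSystem.Planar (S : C.RotationSystem) : Prop :=
  ∀ a, ∃ R : (C.link a).RotationSystem, S.Induces R ∧ R.Planar

variable (C)

/-- The link graph at `a` is loop-planar if it has a planar rotation system such that for every
loop of `C` at `a` the rotators at the two corresponding vertices are reverse, where an
edge at the one vertex corresponds to the edge at the other vertex that comes from the same face. -/
def LoopPlanar (a : C.V) : Prop :=
  ∃ R : (C.link a).RotationSystem, R.Planar ∧
    ∀ (e : C.E) (k m : C.LinkEdge a × Bool),
      ((C.link a).endpoint k).1 = (e, true) → ((C.link a).endpoint m).1 = (e, false) →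
      k.1.1.1 = m.1.1.1 → (R.next k).1.1.1 = (R.next.symm m).1.1.1

/-- `C` is locally planar if all its link graphs are loop-planar. -/
def LocallyPlanar : Prop := ∀ a, C.LoopPlanar a

/-! ### Contractions -/

/-- Two vertices are identified by contracting `x` if they are equal or both are endvertices of
`x`. -/
def contractSetoid (x : C.E) : Setoid C.V where
  r a b := a = b ∨
    ((∃ i, C.graph.endpoint (x, i) = a) ∧ ∃ j, C.graph.endpoint (x, j) = b)
  iseqv :=
    { refl := fun _ => Or.inl rfl
      symm := by
        rintro a b (h | ⟨h, h'⟩)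
        · exact Or.inl h.symm
        · exact Or.inr ⟨h', h⟩
      trans := by
        rintro a b c (rfl | ⟨h, h'⟩) (rfl | ⟨h2, h3⟩)
        · exact Or.inl rfl
        · exact Or.inr ⟨h2, h3⟩
        · exact Or.inr ⟨h, h'⟩
        · exact Or.inr ⟨h, h3⟩ }

/-- The graph `(V, E) / x`. -/
def contractGraph (x : C.E) :
    Multigraph (Quotient (C.contractSetoid x)) {e : C.E // e ≠ x} where
  endpoint h := Quotient.mk _ (C.graph.endpoint (h.1.1, h.2))

open Classical in
/-- Deleting the edge `x` from a list of darts. -/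
noncomputable def deleteEdge (x : C.E) (l : List (C.E × Bool)) :
    List ({e : C.E // e ≠ x} × Bool) :=
  l.filterMap fun d => if h : d.1 ≠ x then some (⟨d.1, h⟩, d.2) else none

theorem mem_deleteEdge {x : C.E} {l : List (C.E × Bool)} {d : {e : C.E // e ≠ x} × Bool} :
    d ∈ C.deleteEdge x l ↔ (d.1.1, d.2) ∈ l := by
  classical
  obtain ⟨⟨e, he⟩, i⟩ := d
  simp only [deleteEdge, List.mem_filterMap]
  constructor
  · rintro ⟨⟨e', j⟩, h, h'⟩
    split_ifs at h' with h1
    simp only [Option.some.injEq, Prod.mk.injEq, Subtype.mk.injEq] at h'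
    obtain ⟨rfl, rfl⟩ := h'
    exact h
  · intro h
    exact ⟨_, h, by simp [he]⟩

theorem map_deleteEdge (x : C.E) (l : List (C.E × Bool)) :
    (((C.deleteEdge x l).map Prod.fst).map Subtype.val).Sublist (l.map Prod.fst) := by
  classical
  induction l with
  | nil => simp [deleteEdge]
  | cons d l ih =>
    by_cases h : d.1 = x
    · have : C.deleteEdge x (d :: l) = C.deleteEdge x l := by simp [deleteEdge, h]
      rw [this]
      exact ih.trans (by simp)
    · have : C.deleteEdge x (d :: l) = (⟨d.1, h⟩, d.2) :: C.deleteEdge x l := by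
        simp [deleteEdge, h]
      rw [this]
      simpa using ih

theorem isWalk_deleteEdge (x : C.E) (l : List (C.E × Bool)) (a b : C.V)
    (h : C.graph.IsWalk a l b) :
    (C.contractGraph x).IsWalk (Quotient.mk _ a) (C.deleteEdge x l) (Quotient.mk _ b) := by
  classical
  induction l generalizing a with
  | nil => cases h; rfl
  | cons d l ih =>
    have ih' := ih _ h.2
    by_cases hd : d.1 = x
    · have : C.deleteEdge x (d :: l) = C.deleteEdge x l := by simp [deleteEdge, hd]
      rw [this]
      have hq : (Quotient.mk (C.contractSetoid x) (C.graph.endpoint d)) = Quotient.mk _ a := by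
        refine Quotient.sound (Or.inr ⟨⟨d.2, by rw [← hd]⟩, ⟨!d.2, ?_⟩⟩)
        rw [← h.1, ← hd]
        rfl
      rwa [hq] at ih'
    · have : C.deleteEdge x (d :: l) = (⟨d.1, hd⟩, d.2) :: C.deleteEdge x l := by
        simp [deleteEdge, hd]
      rw [this]
      exact ⟨by rw [← h.1]; rfl, ih'⟩

theorem deleteEdge_face_ne_nil (x : C.E) (hx : ¬ C.graph.IsLoop x) (f : C.F) :
    C.deleteEdge x (C.face f) ≠ [] := by
  classical
  intro h
  have hall : ∀ d ∈ C.face f, d.1 = x := by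
    intro d hd
    by_contra hne
    have : ((⟨d.1, hne⟩, d.2) : {e : C.E // e ≠ x} × Bool) ∈ C.deleteEdge x (C.face f) :=
      (C.mem_deleteEdge).2 hd
    rw [h] at this
    simp at this
  obtain ⟨a, ha⟩ := C.face_closed f
  have hnd := C.face_nodup f
  have hne := C.face_ne_nil f
  rcases hl : C.face f with _ | ⟨d, _ | ⟨d', l⟩⟩
  · exact hne hl
  · rw [hl] at ha hall
    have h1 : C.graph.endpoint (halfFlip d) = a := ha.1
    have h2 : C.graph.endpoint d = a := ha.2
    have h3 : d.1 = x := hall d (by simp)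
    obtain ⟨e, i⟩ := d
    subst h3
    apply hx
    cases i
    · exact h2.trans h1.symm
    · exact h1.trans h2.symm
  · rw [hl] at hnd hall
    have h1 := hall d (by simp)
    have h2 := hall d' (by simp)
    simp [h1, h2] at hnd

/-- The 2-complex `C / x` obtained by contracting the non-loop edge `x`: the endvertices of `x` are
identified, and `x` is deleted from all faces and from the graph. -/
noncomputable def contract (x : C.E) (hx : ¬ C.graph.IsLoop x) : TwoComplex.{u} where
  V := Quotient (C.contractSetoid x)
  E := {e : C.E // e ≠ x}
  F := C.F
  finite_V := have := C.finite_V; inferInstance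
  finite_E := have := C.finite_E; inferInstance
  finite_F := C.finite_F
  graph := C.contractGraph x
  face f := C.deleteEdge x (C.face f)
  face_ne_nil := C.deleteEdge_face_ne_nil x hx
  face_nodup f := ((C.face_nodup f).sublist (C.map_deleteEdge x (C.face f))).of_map
  face_closed f := by
    obtain ⟨a, ha⟩ := C.face_closed f
    exact ⟨_, C.isWalk_deleteEdge x _ a a ha⟩
  edge_incident := by
    rintro ⟨e, he⟩
    obtain ⟨f, hf⟩ := C.edge_incident e
    obtain ⟨⟨e', i⟩, hd, rfl⟩ := List.mem_map.1 hf
    exact ⟨f, List.mem_map.2 ⟨(⟨e', he⟩, i), (C.mem_deleteEdge).2 hd, rfl⟩⟩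
  vertex_incident := by
    have key : ∀ (f : C.F) (d : C.E × Bool), d ∈ C.face f → d.1 ≠ x →
        ∀ q, Quotient.mk (C.contractSetoid x) (C.graph.endpoint d) = q →
        ∃ f, ∃ d ∈ C.deleteEdge x (C.face f), (C.contractGraph x).endpoint d = q :=
      fun f d hd hne q hq => ⟨f, (⟨d.1, hne⟩, d.2), (C.mem_deleteEdge).2 hd, hq⟩
    intro q
    induction q using Quotient.inductionOn with
    | _ a =>
      obtain ⟨f, d, hd, rfl⟩ := C.vertex_incident a
      by_cases hdx : d.1 = x
      · obtain ⟨b, hb⟩ := C.face_closed f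
        obtain ⟨s, t, hst⟩ := List.append_of_mem hd
        rw [hst] at hb
        obtain ⟨c, h1, h2⟩ := Multigraph.IsWalk.split _ hb
        have hw := C.isWalk_deleteEdge x _ _ _ (Multigraph.IsWalk.append _ h2.2 h1)
        have hc : (Quotient.mk (C.contractSetoid x) c)
            = Quotient.mk _ (C.graph.endpoint d) := by
          refine Quotient.sound (Or.inr ⟨⟨!d.2, ?_⟩, ⟨d.2, by rw [← hdx]⟩⟩)
          rw [← h2.1, ← hdx]
          rfl
        rw [hc] at hw
        have hne : C.deleteEdge x (t ++ s) ≠ [] := by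
          intro h0
          apply C.deleteEdge_face_ne_nil x hx f
          rw [hst]
          have : C.deleteEdge x (t ++ s) = C.deleteEdge x t ++ C.deleteEdge x s := by
            simp [deleteEdge]
          rw [this, List.append_eq_nil_iff] at h0
          have h4 : C.deleteEdge x (s ++ d :: t) = C.deleteEdge x s ++ C.deleteEdge x t := by
            simp [deleteEdge, hdx]
          rw [h4, h0.1, h0.2]
          rfl
        obtain ⟨r, d', hr⟩ := (List.eq_nil_or_concat' (C.deleteEdge x (t ++ s))).resolve_left hne
        refine ⟨f, d', ?_, ?_⟩
        · have hm : d' ∈ C.deleteEdge x (t ++ s) := by rw [hr]; simp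
          rw [mem_deleteEdge] at hm ⊢
          rw [hst]
          simp only [List.mem_append, List.mem_cons] at hm ⊢
          tauto
        · rw [hr] at hw
          obtain ⟨_, _, h6⟩ := Multigraph.IsWalk.split _ hw
          exact h6.2
      · exact key f d hd hdx _ rfl

/-- `D` is a contraction of `C`: it arises from `C` by successively contracting (zero or more)
edges that are not loops at the time of their contraction. -/
inductive IsContraction (C : TwoComplex.{u}) : TwoComplex.{u} → Prop
  | refl : IsContraction C C
  | step (D : TwoComplex.{u}) (x : D.E) (hx : ¬ D.graph.IsLoop x) :
      IsContraction C D → IsContraction C (D.contract x hx)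

end TwoComplex

/-!
A permutation-theoretic form of the statement is used. Let the *flags* of a 2-complex be the pairs of a
face and a half-edge of an edge on that face. They are the half-edges of the disjoint union of all
link graphs, so a rotation system of all link graphs is a permutation `σ` of the flags. It is induced
by a rotation system of the 2-complex if and only if exchanging the two halves of each edge conjugates
`σ` to its inverse (`TwoComplex.IsReversing`).

Planarity is replaced by a homological condition that needs neither counting nor a decomposition into
components: by Euler's formula and a comparison of dimensions, a rotation system of a connected graph
is planar if and only if every cycle with coefficients in `ℤ/2` is a sum of boundaries of faces
(`Multigraph.planar_iff_homologyTrivial`, `TwoComplex.planar_iff_homologyTrivial`).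

Contracting a non-loop edge `x` replaces the link graphs at its endvertices by their vertex sum
(`TwoComplex.contractVertexSum`), and the main point is that planarity passes through a vertex sum in
both directions. Forwards, a cycle of the vertex sum splits into cycles of the two summands, and sets of
faces that they bound can be chosen so that they match along the cut, because the rotators at the two
ends of `x` are reverse
(`HalfEdgeGraph.VertexSum.homologyTrivial_of_homologyTrivial`). Backwards, the order in which the
facial walks of the vertex sum cross the cut is a cyclic order of the merged edges, as the summands
are connected without the glued vertex; it gives the rotators at the two ends of `x`, and cycles of the
summands extend to cycles of the vertex sum
(`HalfEdgeGraph.VertexSum.exists_rotation_of_homologyTrivial`). Only one consequence of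
3-connectedness is needed: link graphs have no loops, are connected, and stay connected when a vertex
is deleted. This property is preserved by vertex sums (`TwoComplex.LinkBiconnected.contract`).

Hence a planar rotation system of the 2-complex gives one of each contraction, which restricts to
loop-planar rotation systems of the link graphs. Conversely, contract edges until all edges are loops.
There, local planarity says precisely that the planar rotation systems of the link graphs fit together
to a planar rotation system (`TwoComplex.exists_isPlanarRotation_of_loops`), which lifts
back along the contractions. The uniqueness of embeddings of 3-connected graphs is not used.
-/

/-! ### Graphs presented by half-edges -/

/-- A graph presented by its set `X` of half-edges: `flip` exchanges the two halves of an edge and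
`vert` gives the vertex to which a half-edge is attached. -/
structure HalfEdgeGraph (X W : Type*) where
  flip : X → X
  vert : X → W
  flip_flip : ∀ p, flip (flip p) = p

/-- The sums of a function over the fibres of `f`. If `z` is a set of edges, seen as a function on
half-edges, and `f` gives the vertices of half-edges, then this is the boundary of `z`. -/
noncomputable def fibreSum {X W : Type*} [Finite X] (f : X → W) :
    (X → ZMod 2) →ₗ[ZMod 2] (W → ZMod 2) :=
  letI := Fintype.ofFinite X
  letI := Classical.decEq W
  { toFun := fun z w => ∑ p with f p = w, z p
    map_add' := fun _ _ => by ext; simp [Finset.sum_add_distrib]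
    map_smul' := fun _ _ => by ext; simp [Finset.mul_sum] }

theorem fibreSum_apply {X W : Type*} [Fintype X] [DecidableEq W] (f : X → W) (z : X → ZMod 2)
    (w : W) : fibreSum f z w = ∑ p with f p = w, z p := by
  unfold fibreSum
  simp only [LinearMap.coe_mk, AddHom.coe_mk]
  congr!

theorem fibreSum_single {X W : Type*} [Finite X] [DecidableEq X] [DecidableEq W] (f : X → W)
    (p : X) : fibreSum f (Pi.single p 1) = Pi.single (f p) 1 := by
  have := Fintype.ofFinite X
  ext w
  rw [fibreSum_apply, Finset.sum_filter]
  simp only [Pi.single_apply]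
  rw [Finset.sum_eq_single p]
  · simp [eq_comm]
  · intro b _ hb; simp [hb]
  · simp

theorem sum_fibreSum {X W : Type*} [Fintype X] [Fintype W] (f : X → W) (z : X → ZMod 2) :
    ∑ w, fibreSum f z w = ∑ p, z p := by
  classical
  simp only [fibreSum_apply]
  exact Finset.sum_fiberwise _ _ _

theorem fibreSum_eq_zero {X W : Type*} [Finite X] (f : X → W) (z : X → ZMod 2) (w : W)
    (h : ∀ p, f p = w → z p = 0) : fibreSum f z w = 0 := by
  classical
  have := Fintype.ofFinite X
  rw [fibreSum_apply]
  exact Finset.sum_eq_zero fun p hp => h p (by simpa using hp)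

theorem fibreSum_congr {X W : Type*} [Finite X] (f : X → W) (z z' : X → ZMod 2) (w : W)
    (h : ∀ p, f p = w → z p = z' p) : fibreSum f z w = fibreSum f z' w := by
  classical
  have := Fintype.ofFinite X
  rw [fibreSum_apply, fibreSum_apply]
  exact Finset.sum_congr rfl fun p hp => h p (by simpa using hp)

/-- Fibre sums are transported by maps that restrict to a bijection between the fibres. -/
theorem fibreSum_comp {X W X' W' : Type*} [Finite X] [Finite X'] (f : X → W) (f' : X' → W')
    (i : X' → X) (hi : Function.Injective i) (w : W) (w' : W')
    (h : ∀ p', f (i p') = w ↔ f' p' = w') (hs : ∀ p, f p = w → p ∈ Set.range i)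
    (z : X → ZMod 2) : fibreSum f' (z ∘ i) w' = fibreSum f z w := by
  classical
  have := Fintype.ofFinite X
  have := Fintype.ofFinite X'
  rw [fibreSum_apply, fibreSum_apply]
  refine Finset.sum_bij (fun p _ => i p) ?_ ?_ ?_ ?_
  · intro p hp; simpa [h] using hp
  · intro p _ q _ hpq; exact hi hpq
  · intro p hp
    obtain ⟨q, rfl⟩ := hs p (by simpa using hp)
    exact ⟨q, by simpa [h] using hp, rfl⟩
  · intro p _; rfl

namespace HalfEdgeGraph

variable {X W : Type*} (M : HalfEdgeGraph X W)

/-- Two vertices are joined by an edge. -/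
def Adj (c d : W) : Prop := ∃ p, M.vert p = c ∧ M.vert (M.flip p) = d

/-- The permutation `σ` is a rotation system: its cycles are the sets of half-edges at a common
vertex. -/
def IsRotation (σ : Equiv.Perm X) : Prop := ∀ p q, σ.SameCycle p q ↔ M.vert p = M.vert q

/-- A cycle in the sense of homology with coefficients in `ℤ/2`. It is given as a function on the
half-edges with the same value on both halves of each edge. -/
structure IsCycle [Finite X] (z : X → ZMod 2) : Prop where
  flip : ∀ p, z (M.flip p) = z p
  sum : ∀ w, fibreSum M.vert z w = 0

/-- The surface defined by the rotation system `σ` has trivial first homology with coefficients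
in `ℤ/2`: every cycle `z` is the sum of the boundaries of a set of faces. The set of faces is given
by its indicator function, evaluated at half-edges: `s p` refers to the face whose boundary traverses
the edge of `p` beginning with `p`. -/
def HomologyTrivial [Finite X] (σ : Equiv.Perm X) : Prop :=
  ∀ z, M.IsCycle z → ∃ s : X → ZMod 2,
    (∀ p, s (σ (M.flip p)) = s p) ∧ ∀ p, z p = s p + s (M.flip p)

variable {M}

theorem IsCycle.add [Finite X] {z z' : X → ZMod 2} (h : M.IsCycle z) (h' : M.IsCycle z') :
    M.IsCycle (z + z') :=
  ⟨fun p => by simp [h.flip, h'.flip], fun w => by simp [h.sum, h'.sum]⟩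

theorem IsRotation.vert_apply {σ : Equiv.Perm X} (h : M.IsRotation σ) (p : X) :
    M.vert (σ p) = M.vert p :=
  ((h p (σ p)).1 ⟨1, by simp⟩).symm

/-- A function that is invariant under rotation at a vertex is constant there. -/
theorem IsRotation.eq_of_invariant {β : Type*} [Finite X] {σ : Equiv.Perm X} (h : M.IsRotation σ)
    {w : W} (g : X → β) (hg : ∀ p, M.vert p = w → g (σ p) = g p) {p q : X} (hp : M.vert p = w)
    (hq : M.vert q = w) : g q = g p := by
  obtain ⟨n, -, rfl⟩ := ((h p q).2 (hp.trans hq.symm)).exists_pow_eq'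
  have : ∀ n : ℕ, M.vert ((σ ^ n) p) = w ∧ g ((σ ^ n) p) = g p := by
    intro n
    induction n with
    | zero => exact ⟨hp, rfl⟩
    | succ n ih =>
      rw [pow_succ', Equiv.Perm.mul_apply]
      exact ⟨(h.vert_apply _).trans ih.1, (hg _ ih.1).trans ih.2⟩
  exact (this n).2

theorem sum_eq_zero_of_flip [Fintype X] (hM : ∀ p, M.flip p ≠ p) {z : X → ZMod 2}
    (hz : ∀ p, z (M.flip p) = z p) : ∑ p, z p = 0 :=
  Finset.sum_involution (fun p _ => M.flip p)
    (fun p _ => by rw [hz]; exact CharTwo.add_self_eq_zero _) (fun p _ _ => hM p)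
    (fun _ _ => Finset.mem_univ _) (fun p _ => M.flip_flip p)

/-- The boundary of the path between two connected vertices. -/
theorem exists_join_pair [Finite X] [DecidableEq W] (A : Set W) {c d : W}
    (h : Relation.ReflTransGen (fun c d => M.Adj c d ∧ c ∈ A ∧ d ∈ A) c d) :
    ∃ y : X → ZMod 2, (∀ p, y (M.flip p) = y p) ∧ (∀ p, M.vert p ∉ A → y p = 0) ∧
      fibreSum M.vert y = Pi.single c 1 + Pi.single d 1 := by
  classical
  induction h with
  | refl => exact ⟨0, by simp, by simp, by ext; simp [CharTwo.add_self_eq_zero]⟩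
  | @tail d e _ h ih =>
    obtain ⟨y, h1, h2, h3⟩ := ih
    obtain ⟨⟨p, rfl, rfl⟩, hd, he⟩ := h
    have hfl : ∀ q r, M.flip q = r ↔ q = M.flip r := fun q r =>
      ⟨fun h => by rw [← h, M.flip_flip], fun h => by rw [h, M.flip_flip]⟩
    refine ⟨y + (Pi.single p 1 + Pi.single (M.flip p) 1), ?_, ?_, ?_⟩
    · intro q
      simp only [Pi.add_apply, h1, Pi.single_apply, hfl, M.flip_flip]
      ring
    · intro q hq
      have : q ≠ p := by rintro rfl; exact hq hd
      have : q ≠ M.flip p := by rintro rfl; exact hq he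
      simp [*]
    · rw [map_add, map_add, h3, fibreSum_single, fibreSum_single]
      ext w
      simp only [Pi.add_apply]
      have : ∀ a b c : ZMod 2, a + b + (b + c) = a + c := by decide
      exact this _ _ _

/-- In a connected graph, each set of evenly many vertices is the set of vertices of odd degree of
some set of edges. -/
theorem exists_join [Finite X] [Fintype W] (A : Set W)
    (hA : ∀ c ∈ A, ∀ d ∈ A, Relation.ReflTransGen (fun c d => M.Adj c d ∧ c ∈ A ∧ d ∈ A) c d)
    (t : W → ZMod 2) (ht : ∀ w, w ∉ A → t w = 0) (hs : ∑ w, t w = 0) :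
    ∃ y : X → ZMod 2, (∀ p, y (M.flip p) = y p) ∧ (∀ p, M.vert p ∉ A → y p = 0) ∧
      fibreSum M.vert y = t := by
  classical
  rcases A.eq_empty_or_nonempty with rfl | ⟨w₀, hw₀⟩
  · exact ⟨0, by simp, by simp, by ext w; simp [ht w]⟩
  have : ∀ w, ∃ y : X → ZMod 2, (∀ p, y (M.flip p) = y p) ∧ (∀ p, M.vert p ∉ A → y p = 0) ∧
      (w ∈ A → fibreSum M.vert y = Pi.single w 1 + Pi.single w₀ 1) := by
    intro w
    by_cases hw : w ∈ A
    · obtain ⟨y, h1, h2, h3⟩ := exists_join_pair A (hA w hw w₀ hw₀)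
      exact ⟨y, h1, h2, fun _ => h3⟩
    · exact ⟨0, by simp, by simp, fun h => absurd h hw⟩
  choose y h1 h2 h3 using this
  refine ⟨∑ w, t w • y w, ?_, ?_, ?_⟩
  · intro p; simp [h1]
  · intro p hp; simp [h2 _ p hp]
  · rw [map_sum]
    have : ∀ w, fibreSum M.vert (t w • y w)
        = t w • Pi.single w 1 + t w • (Pi.single w₀ 1 : W → ZMod 2) := by
      intro w
      by_cases hw : w ∈ A
      · rw [map_smul, h3 w hw, smul_add]
      · simp [ht w hw]
    simp only [this, Finset.sum_add_distrib, ← Finset.sum_smul, hs, zero_smul, add_zero]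
    ext w
    simp [Finset.sum_apply, Pi.single_apply]

end HalfEdgeGraph

namespace Multigraph

variable {V : Type u} {E : Type v} (G : Multigraph V E)

/-- A multigraph as a graph presented by its half-edges. -/
def toHalfEdgeGraph : HalfEdgeGraph (E × Bool) V where
  flip := halfFlip
  vert := G.endpoint
  flip_flip := by rintro ⟨e, i⟩; simp [halfFlip]

theorem range_fibreSum_eq [Finite V] [Finite E] [Fintype V]
    (hc : ∀ a b, Relation.ReflTransGen G.Adj a b) (t : V → ZMod 2) (ht : ∑ w, t w = 0) :
    ∃ y : E → ZMod 2, fibreSum G.endpoint (fun h => y h.1) = t := by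
  obtain ⟨y, h1, -, h3⟩ := G.toHalfEdgeGraph.exists_join Set.univ
    (fun c _ d _ => by
      exact Relation.ReflTransGen.mono (fun a b h => ⟨h, trivial, trivial⟩) _ _ (hc c d)) t (by simp) ht
  refine ⟨fun e => y (e, false), ?_⟩
  rw [← h3]
  congr 1
  ext ⟨e, i⟩
  cases i
  · rfl
  · exact h1 (e, true)

end Multigraph

/-! ### Planarity and homology -/

namespace Multigraph

variable {V : Type u} {E : Type v} (G : Multigraph V E)

theorem halfFlip_halfFlip (h : E × Bool) : halfFlip (halfFlip h) = h := by
  obtain ⟨e, i⟩ := h; simp [halfFlip]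

variable {G}

/-- The edge-boundary of a set of faces, as a linear map. -/
noncomputable def RotationSystem.faceBoundary (R : G.RotationSystem) :
    (Quotient (Equiv.Perm.SameCycle.setoid R.faceWalk) → ZMod 2) →ₗ[ZMod 2] (E → ZMod 2) where
  toFun s e := s (Quotient.mk _ (e, false)) + s (Quotient.mk _ (e, true))
  map_add' _ _ := by ext; simp only [Pi.add_apply]; ring
  map_smul' _ _ := by ext; simp [mul_add]

theorem RotationSystem.isRotation (R : G.RotationSystem) :
    G.toHalfEdgeGraph.IsRotation R.next := R.sameCycle_iff

/-- The boundary of a set of edges, as a linear map: the set of vertices that are incident with an odd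
number of its edges. -/
noncomputable def edgeBoundary [Finite E] (G : Multigraph V E) :
    (E → ZMod 2) →ₗ[ZMod 2] (V → ZMod 2) :=
  fibreSum G.endpoint ∘ₗ LinearMap.funLeft (ZMod 2) (ZMod 2) Prod.fst

theorem finrank_sum_zero (V : Type*) [Fintype V] [Nonempty V] :
    Module.finrank (ZMod 2)
      (LinearMap.ker (Fintype.linearCombination (ZMod 2) (fun _ : V => (1 : ZMod 2)))) + 1
      = Fintype.card V := by
  classical
  have h := LinearMap.finrank_range_add_finrank_ker
    (Fintype.linearCombination (ZMod 2) (fun _ : V => (1 : ZMod 2)))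
  have hr : LinearMap.range (Fintype.linearCombination (ZMod 2) (fun _ : V => (1 : ZMod 2)))
      = ⊤ := by
    rw [LinearMap.range_eq_top]
    intro c
    obtain ⟨w⟩ := ‹Nonempty V›
    exact ⟨Pi.single w c, by simp [Fintype.linearCombination_apply, Pi.single_apply]⟩
  rw [hr, finrank_top, Module.finrank_self, Module.finrank_fintype_fun_eq_card] at h
  omega

theorem finrank_ker_edgeBoundary [Fintype V] [Fintype E] [Nonempty V]
    (hc : ∀ a b, Relation.ReflTransGen G.Adj a b) :
    Module.finrank (ZMod 2) (LinearMap.ker G.edgeBoundary) + Fintype.card V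
      = Fintype.card E + 1 := by
  have h := LinearMap.finrank_range_add_finrank_ker G.edgeBoundary
  have hr : LinearMap.range G.edgeBoundary =
      LinearMap.ker (Fintype.linearCombination (ZMod 2) (fun _ : V => (1 : ZMod 2))) := by
    ext t
    simp only [LinearMap.mem_range, LinearMap.mem_ker, Fintype.linearCombination_apply,
      smul_eq_mul, mul_one]
    constructor
    · rintro ⟨y, rfl⟩
      refine (sum_fibreSum _ _).trans
        (HalfEdgeGraph.sum_eq_zero_of_flip (M := G.toHalfEdgeGraph) ?_ ?_)
      · rintro ⟨e, i⟩; simp [toHalfEdgeGraph, halfFlip]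
      · rintro ⟨e, i⟩; simp [toHalfEdgeGraph, halfFlip, LinearMap.funLeft]
    · intro ht
      exact G.range_fibreSum_eq hc t ht
  have h2 := finrank_sum_zero V
  rw [← hr] at h2
  rw [Module.finrank_fintype_fun_eq_card] at h
  omega

theorem finrank_range_faceBoundary [Finite E] [Nonempty E]
    (hc : ∀ a b, Relation.ReflTransGen G.Adj a b) (R : G.RotationSystem) :
    Module.finrank (ZMod 2) (LinearMap.range R.faceBoundary) + 1
      = Nat.card (Quotient (Equiv.Perm.SameCycle.setoid R.faceWalk)) := by
  classical
  have := Fintype.ofFinite (Quotient (Equiv.Perm.SameCycle.setoid R.faceWalk))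
  have h := LinearMap.finrank_range_add_finrank_ker R.faceBoundary
  have hk : LinearMap.ker R.faceBoundary = Submodule.span (ZMod 2) {fun _ => 1} := by
    ext s
    rw [LinearMap.mem_ker, Submodule.mem_span_singleton]
    constructor
    · intro hs
      -- `s` takes the same value on both sides of each edge, so it is constant around vertices
      have hflip : ∀ h : E × Bool, s (Quotient.mk _ (halfFlip h)) = s (Quotient.mk _ h) := by
        have : ∀ e, s (Quotient.mk _ (e, false)) = s (Quotient.mk _ (e, true)) := fun e =>
          CharTwo.add_eq_zero.1 (congrFun hs e)
        rintro ⟨e, i⟩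
        cases i
        · exact (this e).symm
        · exact this e
      have hnext : ∀ h : E × Bool, s (Quotient.mk _ (R.next h)) = s (Quotient.mk _ h) := by
        intro h
        rw [← hflip h]
        congr 1
        refine Quotient.sound (Equiv.Perm.SameCycle.symm ⟨1, ?_⟩)
        simp [RotationSystem.faceWalk, halfFlip_halfFlip]
      obtain ⟨e₀⟩ := ‹Nonempty E›
      have key : ∀ b, Relation.ReflTransGen G.Adj (G.endpoint (e₀, false)) b → ∀ h,
          G.endpoint h = b → s (Quotient.mk _ h) = s (Quotient.mk _ (e₀, false)) := by
        intro b hb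
        induction hb with
        | refl =>
          intro h hh
          exact R.isRotation.eq_of_invariant
            (fun h => s (Quotient.mk _ h)) (fun p _ => hnext p) rfl hh
        | tail _ h1 ih =>
          obtain ⟨k, hk1, hk2⟩ := h1
          intro h hh
          rw [← ih k hk1, ← hflip k]
          exact R.isRotation.eq_of_invariant
            (fun h => s (Quotient.mk _ h)) (fun p _ => hnext p) hk2 hh
      refine ⟨s (Quotient.mk _ (e₀, false)), ?_⟩
      ext q
      induction q using Quotient.inductionOn with
      | _ h => simpa using (key _ (hc _ _) h rfl).symm
    · rintro ⟨c, rfl⟩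
      ext e
      simp [RotationSystem.faceBoundary, CharTwo.add_self_eq_zero]
  rw [hk, finrank_span_singleton, Module.finrank_fintype_fun_eq_card] at h
  · rw [Nat.card_eq_fintype_card]; exact h
  · obtain ⟨e₀⟩ := ‹Nonempty E›
    intro h0
    exact one_ne_zero (congrFun h0 (Quotient.mk _ (e₀, false)))

theorem range_faceBoundary_le [Finite E] (R : G.RotationSystem) :
    LinearMap.range R.faceBoundary ≤ LinearMap.ker G.edgeBoundary := by
  classical
  have := Fintype.ofFinite E
  rintro _ ⟨s, rfl⟩
  rw [LinearMap.mem_ker]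
  ext w
  set u : E × Bool → ZMod 2 := fun h => s (Quotient.mk _ h) with hu
  have h1 : ∀ h : E × Bool, R.faceBoundary s h.1 = u h + u (R.next h) := by
    have h2 : ∀ h : E × Bool, u (halfFlip h) = u (R.next h) := by
      intro h
      refine congrArg s (Quotient.sound ⟨1, ?_⟩)
      simp [RotationSystem.faceWalk, halfFlip_halfFlip]
    intro h
    rw [← h2]
    obtain ⟨e, i⟩ := h
    cases i
    · rfl
    · exact add_comm _ _
  have h3 : G.edgeBoundary (R.faceBoundary s) w
      = ∑ h with G.endpoint h = w, (u h + u (R.next h)) := by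
    refine (fibreSum_apply _ _ _).trans (Finset.sum_congr rfl fun h _ => h1 h)
  have h4 : ∑ h with G.endpoint h = w, u (R.next h) = ∑ h with G.endpoint h = w, u h := by
    refine Finset.sum_equiv R.next (fun h => ?_) (fun _ _ => rfl)
    have : G.endpoint (R.next h) = G.endpoint h := R.isRotation.vert_apply h
    simp [this]
  rw [h3, Finset.sum_add_distrib, h4]
  exact CharTwo.add_self_eq_zero _

/-- By Euler's formula, a rotation system of a connected graph is planar if and only if the first
homology of its surface is trivial: the cycle space of the graph has dimension `|E| - |V| + 1`
and the boundaries of the faces span a subspace of dimension `|F| - 1`. -/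
theorem planar_iff_homologyTrivial [Finite V] [Finite E]
    (hc : ∀ a b, Relation.ReflTransGen G.Adj a b) (R : G.RotationSystem) :
    R.Planar ↔ G.toHalfEdgeGraph.HomologyTrivial R.next := by
  classical
  have := Fintype.ofFinite E
  have := Fintype.ofFinite V
  rcases isEmpty_or_nonempty E with hE | hE
  · exact ⟨fun _ _ _ => ⟨0, by simp, fun p => isEmptyElim p.1⟩, fun _ e => isEmptyElim e⟩
  have : Nonempty V := hE.map fun e => G.endpoint (e, false)
  have hcomp : ∀ a, G.component a = Set.univ := fun a => Set.eq_univ_of_forall (hc a)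
  have h1 : R.Planar ↔ Fintype.card V
      + Nat.card (Quotient (Equiv.Perm.SameCycle.setoid R.faceWalk)) = Fintype.card E + 2 := by
    have hf : R.facesIn Set.univ = Set.univ := by
      refine Set.eq_univ_of_forall fun q => ?_
      induction q using Quotient.inductionOn with
      | _ h => exact ⟨h, trivial, rfl⟩
    simp only [RotationSystem.Planar, hcomp, hf, Set.mem_univ, Set.ofPred_true, Set.ncard_univ,
      forall_const, Nat.card_eq_fintype_card]
  have h2 : LinearMap.range R.faceBoundary = LinearMap.ker G.edgeBoundary ↔ Fintype.card V
      + Nat.card (Quotient (Equiv.Perm.SameCycle.setoid R.faceWalk)) = Fintype.card E + 2 := by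
    have hk := finrank_ker_edgeBoundary hc
    have hr := finrank_range_faceBoundary hc R
    constructor
    · intro h
      rw [h] at hr
      omega
    · intro h
      exact Submodule.eq_of_le_of_finrank_eq (range_faceBoundary_le R) (by omega)
  rw [h1, ← h2]
  constructor
  · intro h z hz
    have hz' : (fun h : E × Bool => z (h.1, false)) = z := by
      ext ⟨e, i⟩
      cases i
      · rfl
      · exact hz.flip (e, true)
    have hmem : (fun e => z (e, false)) ∈ LinearMap.ker G.edgeBoundary := by
      rw [LinearMap.mem_ker]
      ext w
      exact (congrArg (fun z => fibreSum G.endpoint z w) hz').trans (hz.sum w)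
    rw [← h] at hmem
    obtain ⟨s, hs⟩ := hmem
    refine ⟨fun h => s (Quotient.mk _ h), ?_, ?_⟩
    · intro p
      exact congrArg s (Quotient.sound (Equiv.Perm.SameCycle.symm ⟨1, rfl⟩))
    · rintro ⟨e, i⟩
      have := congrFun hs e
      cases i
      · exact this.symm
      · exact (hz.flip (e, true)).symm.trans (this.symm.trans (add_comm _ _))
  · intro h
    refine le_antisymm (range_faceBoundary_le R) fun y hy => ?_
    obtain ⟨s, hs1, hs2⟩ := h (fun h => y h.1)
      ⟨fun p => rfl, fun w => congrFun (LinearMap.mem_ker.1 hy) w⟩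
    have hs3 : ∀ p q : E × Bool, R.faceWalk.SameCycle p q → s p = s q := by
      intro p q hpq
      obtain ⟨n, rfl⟩ := hpq.exists_nat_pow_eq
      induction n with
      | zero => rfl
      | succ n ih =>
        rw [pow_succ', Equiv.Perm.mul_apply]
        exact (ih ⟨n, by simp⟩).trans (hs1 _).symm
    exact ⟨Quotient.lift s hs3, by ext e; exact (hs2 (e, false)).symm⟩

end Multigraph

/-! ### Vertex sums of planar rotation systems -/

namespace HalfEdgeGraph

/-- `M'` arises from the graph `M` by a vertex sum: the vertices `a` and `b` of `M`, which lie in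
different parts of `M`, are deleted, and for each half-edge `q` at `a` the edge of `q` and the edge
of the half-edge `τ q` at `b` are merged to a single edge. The function `κ` assigns to a vertex the
part in which it lies (in the application: the vertex of the 2-complex whose link graph this is);
the parts of `a` and `b` become one part of `M'`. -/
structure VertexSum {X W K X' W' K' : Type*} (M : HalfEdgeGraph X W) (κ : W → K)
    (M' : HalfEdgeGraph X' W') (κ' : W' → K') where
  a : W
  b : W
  ι : X' → X
  j : W' → W
  τ : X → X
  ι_injective : Function.Injective ι
  mem_range_ι : ∀ p, p ∈ Set.range ι ↔ M.vert p ≠ a ∧ M.vert p ≠ b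
  j_injective : Function.Injective j
  mem_range_j : ∀ w, w ∈ Set.range j ↔ w ≠ a ∧ w ≠ b
  vert_ι : ∀ p, M.vert (ι p) = j (M'.vert p)
  τ_τ : ∀ p, τ (τ p) = p
  vert_τ_of_a : ∀ p, M.vert p = a → M.vert (τ p) = b
  vert_τ_of_b : ∀ p, M.vert p = b → M.vert (τ p) = a
  vert_flip_ne : ∀ p, M.vert (M.flip p) ≠ M.vert p
  κ_flip : ∀ p, κ (M.vert (M.flip p)) = κ (M.vert p)
  κ_ne : κ a ≠ κ b
  flip_ι : ∀ p, M.vert (M.flip (ι p)) ≠ a → M.vert (M.flip (ι p)) ≠ b →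
    ι (M'.flip p) = M.flip (ι p)
  flip_ι_merged : ∀ p, M.vert (M.flip (ι p)) = a ∨ M.vert (M.flip (ι p)) = b →
    ι (M'.flip p) = M.flip (τ (M.flip (ι p)))
  κ'_eq_iff : ∀ w w', κ' w = κ' w' ↔ κ (j w) = κ (j w') ∨
    ((κ (j w) = κ a ∨ κ (j w) = κ b) ∧ (κ (j w') = κ a ∨ κ (j w') = κ b))

namespace VertexSum

variable {X W K X' W' K' : Type*} {M : HalfEdgeGraph X W} {κ : W → K}
  {M' : HalfEdgeGraph X' W'} {κ' : W' → K'} (A : VertexSum M κ M' κ')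

/-- The vertex sum with the roles of the two vertices exchanged. -/
def symm : VertexSum M κ M' κ' where
  a := A.b
  b := A.a
  ι := A.ι
  j := A.j
  τ := A.τ
  ι_injective := A.ι_injective
  mem_range_ι p := (A.mem_range_ι p).trans and_comm
  j_injective := A.j_injective
  mem_range_j w := (A.mem_range_j w).trans and_comm
  vert_ι := A.vert_ι
  τ_τ := A.τ_τ
  vert_τ_of_a := A.vert_τ_of_b
  vert_τ_of_b := A.vert_τ_of_a
  vert_flip_ne := A.vert_flip_ne
  κ_flip := A.κ_flip
  κ_ne := A.κ_ne.symm
  flip_ι p h h' := A.flip_ι p h' h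
  flip_ι_merged p h := A.flip_ι_merged p h.symm
  κ'_eq_iff w w' := (A.κ'_eq_iff w w').trans (by
    rw [or_comm (a := κ (A.j w) = κ A.a), or_comm (a := κ (A.j w') = κ A.a)])

theorem a_ne_b : A.a ≠ A.b := fun h => A.κ_ne (congrArg κ h)

/-- A half-edge at `a` or `b`. -/
def IsDeleted (p : X) : Prop := M.vert p = A.a ∨ M.vert p = A.b

theorem mem_range {p : X} : p ∈ Set.range A.ι ↔ ¬ A.IsDeleted p := by
  rw [A.mem_range_ι, IsDeleted, not_or]

theorem not_isDeleted_ι (p : X') : ¬ A.IsDeleted (A.ι p) := A.mem_range.1 ⟨p, rfl⟩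

theorem isDeleted_τ {p : X} (h : A.IsDeleted p) : A.IsDeleted (A.τ p) :=
  h.elim (fun h => Or.inr (A.vert_τ_of_a p h)) (fun h => Or.inl (A.vert_τ_of_b p h))

theorem not_isDeleted_flip {p : X} (h : A.IsDeleted p) : ¬ A.IsDeleted (M.flip p) := by
  have h1 := A.vert_flip_ne p
  have h2 := A.κ_flip p
  have h3 := A.κ_ne
  rintro (h4 | h4) <;> rcases h with h | h <;> rw [h, h4] at h1 h2 <;> tauto

theorem exists_ι {p : X} (h : ¬ A.IsDeleted p) : ∃ p', A.ι p' = p := A.mem_range.2 h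

theorem flip_ι' {p : X'} (h : ¬ A.IsDeleted (M.flip (A.ι p))) :
    A.ι (M'.flip p) = M.flip (A.ι p) :=
  A.flip_ι p (fun h' => h (Or.inl h')) (fun h' => h (Or.inr h'))

/-- The edge of the vertex sum that arises from the half-edges `q` and `τ q`. -/
theorem flip_merged {p : X'} {q : X} (hq : A.IsDeleted q) (hp : A.ι p = M.flip q) :
    A.ι (M'.flip p) = M.flip (A.τ q) := by
  have h : M.flip (A.ι p) = q := by rw [hp, M.flip_flip]
  rw [A.flip_ι_merged p (by rw [h]; exact hq), h]

/-- Each half-edge of the vertex sum lies on an edge of `M` or on a merged edge. -/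
theorem flip_cases (p : X') : (A.ι (M'.flip p) = M.flip (A.ι p) ∧ ¬ A.IsDeleted (M.flip (A.ι p))) ∨
    ∃ q, A.IsDeleted q ∧ A.ι p = M.flip q ∧ A.ι (M'.flip p) = M.flip (A.τ q) := by
  by_cases h : A.IsDeleted (M.flip (A.ι p))
  · exact Or.inr ⟨_, h, (M.flip_flip _).symm, A.flip_ι_merged p h⟩
  · exact Or.inl ⟨A.flip_ι' h, h⟩

theorem κ_τ_of_a {q : X} (h : M.vert q = A.a) : κ (M.vert (M.flip (A.τ q))) = κ A.b := by
  rw [A.κ_flip, A.vert_τ_of_a q h]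

/-- The sum of the values of a cycle over a cut is even. -/
theorem fibreSum_a_eq_zero [Finite X] [Finite W] {z : X → ZMod 2} (hz : ∀ p, z (M.flip p) = z p)
    (hs : ∀ w, w ≠ A.a → κ w = κ A.a → fibreSum M.vert z w = 0) :
    fibreSum M.vert z A.a = 0 := by
  classical
  have := Fintype.ofFinite X
  have := Fintype.ofFinite W
  let y : X → ZMod 2 := fun p => if κ (M.vert p) = κ A.a then z p else 0
  have h1 : ∑ p, y p = 0 := by
    refine sum_eq_zero_of_flip (M := M) (fun p h => A.vert_flip_ne p (by rw [h])) fun p => ?_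
    simp only [y, A.κ_flip, hz]
  rw [← sum_fibreSum M.vert, Finset.sum_eq_single A.a] at h1
  · rw [← h1]
    exact fibreSum_congr _ _ _ _ fun p hp => by simp [y, hp]
  · intro w _ hw
    by_cases hk : κ w = κ A.a
    · rw [← hs w hw hk]
      exact fibreSum_congr _ _ _ _ fun p hp => by simp [y, hp, hk]
    · exact fibreSum_eq_zero _ _ _ fun p hp => by simp [y, hp, hk]
  · simp

open Classical in
/-- A set of edges of the vertex sum, as a set of edges of `M` that contains, for each merged edge, both or
none of the edges from which it arises. -/
noncomputable def lift (z : X' → ZMod 2) (p : X) : ZMod 2 :=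
  if A.IsDeleted p then Function.extend A.ι z 0 (M.flip p) else Function.extend A.ι z 0 p

theorem lift_ι (z : X' → ZMod 2) (p : X') : A.lift z (A.ι p) = z p := by
  rw [lift, if_neg (A.not_isDeleted_ι p), A.ι_injective.extend_apply]

theorem lift_comp_ι (z : X' → ZMod 2) : A.lift z ∘ A.ι = z := funext (A.lift_ι z)

theorem lift_deleted (z : X' → ZMod 2) {q : X} (h : A.IsDeleted q) :
    A.lift z (M.flip q) = A.lift z q := by
  rw [lift, lift, if_pos h, if_neg (A.not_isDeleted_flip h)]

section Cycles

variable [Finite X] [Finite X']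

theorem fibreSum_ι (z : X → ZMod 2) (w : W') :
    fibreSum M'.vert (z ∘ A.ι) w = fibreSum M.vert z (A.j w) := by
  refine fibreSum_comp _ _ A.ι A.ι_injective _ _ (fun p => ?_) (fun p hp => ?_) z
  · rw [A.vert_ι, A.j_injective.eq_iff]
  · rw [A.mem_range_ι, hp]; exact (A.mem_range_j _).1 ⟨w, rfl⟩

/-- A cycle that takes the same values at the two vertices that are glued gives a cycle of the
vertex sum. -/
theorem isCycle_comp_ι {z : X → ZMod 2} (hz : M.IsCycle z)
    (h : ∀ q, A.IsDeleted q → z (A.τ q) = z q) : M'.IsCycle (z ∘ A.ι) where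
  flip p := by
    rcases A.flip_cases p with ⟨h1, -⟩ | ⟨q, hq, h1, h2⟩
    · simp only [Function.comp, h1, hz.flip]
    · simp only [Function.comp, h1, h2, hz.flip, h q hq]
  sum w := by rw [A.fibreSum_ι]; exact hz.sum _

theorem isCycle_lift [Finite W] {z : X' → ZMod 2} (hz : M'.IsCycle z) :
    M.IsCycle (A.lift z) ∧ ∀ q, A.IsDeleted q → A.lift z (A.τ q) = A.lift z q := by
  have hfl : ∀ p, A.lift z (M.flip p) = A.lift z p := by
    intro p
    by_cases h : A.IsDeleted p
    · exact A.lift_deleted z h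
    · obtain ⟨p, rfl⟩ := A.exists_ι h
      rcases A.flip_cases p with ⟨h1, -⟩ | ⟨q, hq, h1, h2⟩
      · rw [← h1, A.lift_ι, A.lift_ι, hz.flip]
      · rw [h1, M.flip_flip, A.lift_deleted z hq]
  have hs : ∀ w, w ≠ A.a → w ≠ A.b → fibreSum M.vert (A.lift z) w = 0 := by
    intro w ha hb
    obtain ⟨w, rfl⟩ := (A.mem_range_j w).2 ⟨ha, hb⟩
    rw [← A.fibreSum_ι, A.lift_comp_ι]
    exact hz.sum w
  refine ⟨⟨hfl, fun w => ?_⟩, fun q hq => ?_⟩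
  · by_cases ha : w = A.a
    · subst ha
      refine A.fibreSum_a_eq_zero hfl fun w hw hk => hs w hw ?_
      rintro rfl
      exact A.κ_ne hk.symm
    by_cases hb : w = A.b
    · subst hb
      refine A.symm.fibreSum_a_eq_zero hfl fun w hw hk => hs w ?_ hw
      rintro rfl
      exact A.κ_ne hk
    exact hs w ha hb
  · obtain ⟨p, hp⟩ := A.exists_ι (A.not_isDeleted_flip hq)
    have h1 := A.flip_merged hq hp
    rw [← hfl (A.τ q), ← hfl q, ← hp, ← h1, A.lift_ι, A.lift_ι, hz.flip]

/-- A vertex sum of graphs that are embedded in the sphere, with reverse rotators at the two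
vertices that are glued, is embedded in the sphere. -/
theorem homologyTrivial_of_homologyTrivial [Finite W] {σ : Equiv.Perm X} {σ' : Equiv.Perm X'}
    (hrot : M.IsRotation σ) (hτ : ∀ q, A.IsDeleted q → σ (A.τ (σ q)) = A.τ q)
    (hσ' : ∀ p, A.ι (σ' p) = σ (A.ι p)) (h : M.HomologyTrivial σ) : M'.HomologyTrivial σ' := by
  classical
  intro z hz
  obtain ⟨hcyc, hzτ⟩ := A.isCycle_lift hz
  obtain ⟨s, hs1, hs2⟩ := h _ hcyc
  have hsσ : ∀ q, s (M.flip q) = s (σ q) := fun q => by rw [← hs1 (M.flip q), M.flip_flip]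
  have hz2 : ∀ q, A.lift z q = s q + s (σ q) := fun q => by rw [hs2, hsσ]
  -- the faces on both sides of the cut agree up to a constant, by which `s` can be changed
  have hg : ∀ q, M.vert q = A.a →
      s (σ (σ q)) + s (A.τ (σ q)) = s (σ q) + s (A.τ q) := by
    intro q hq
    have hσq : M.vert (σ q) = A.a := (hrot.vert_apply q).trans hq
    have e1 := hz2 (σ q)
    have e2 := hz2 (A.τ (σ q))
    rw [hzτ (σ q) (Or.inl hσq), hτ q (Or.inl hq)] at e2
    have : ∀ x y z' u w : ZMod 2, w = x + y → w = u + z' → y + u = x + z' := by decide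
    exact this _ _ _ _ _ e1 e2
  obtain ⟨c, hc⟩ : ∃ c, ∀ q, M.vert q = A.a → s (σ q) + s (A.τ q) = c := by
    by_cases hex : ∃ q, M.vert q = A.a
    · obtain ⟨q₀, hq₀⟩ := hex
      exact ⟨_, fun q hq => hrot.eq_of_invariant (fun q => s (σ q) + s (A.τ q)) hg hq₀ hq⟩
    · exact ⟨0, fun q hq => absurd ⟨q, hq⟩ hex⟩
  let t : X → ZMod 2 := fun p => if κ (M.vert p) = κ A.b then s p + c else s p
  have ht1 : ∀ p, t (σ (M.flip p)) = t p := by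
    intro p
    simp only [t, hrot.vert_apply, A.κ_flip, hs1]
  have ht2 : ∀ p, A.lift z p = t p + t (M.flip p) := by
    intro p
    simp only [t, A.κ_flip, hs2 p]
    split_ifs
    · have : ∀ x y c : ZMod 2, x + y = x + c + (y + c) := by decide
      exact this _ _ _
    · rfl
  have htσ : ∀ q, t (M.flip q) = t (σ q) := fun q => by rw [← ht1 (M.flip q), M.flip_flip]
  have hta : ∀ q, M.vert q = A.a → t (σ q) = t (A.τ q) := by
    intro q hq
    simp only [t, hrot.vert_apply, hq, A.vert_τ_of_a q hq, A.κ_ne, if_true, if_false]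
    have : ∀ x y c : ZMod 2, x + y = c → x = y + c := by decide
    exact this _ _ _ (hc q hq)
  -- `τ` conjugates the rotator at `b` to the inverse of the rotator at `a`
  have htb : ∀ q, M.vert q = A.b → t (σ q) = t (A.τ q) := by
    intro q hq
    have h1 : M.vert (σ (A.τ (σ q))) = A.a := by
      rw [hτ q (Or.inr hq)]; exact A.vert_τ_of_b q hq
    have h2 : M.vert (A.τ (σ q)) = A.a := by rwa [hrot.vert_apply] at h1
    have h3 := hta _ h2
    rw [hτ q (Or.inr hq), A.τ_τ] at h3
    exact h3.symm
  have htab : ∀ q, A.IsDeleted q → t (σ q) = t (A.τ q) := fun q hq => hq.elim (hta q) (htb q)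
  refine ⟨t ∘ A.ι, ?_, ?_⟩
  · intro p
    simp only [Function.comp, hσ']
    rcases A.flip_cases p with ⟨h1, -⟩ | ⟨q, hq, h1, h2⟩
    · rw [h1, ht1]
    · rw [h2, h1, ht1, htσ, htab q hq]
  · intro p
    have hp := ht2 (A.ι p)
    rw [A.lift_ι] at hp
    rw [hp]
    simp only [Function.comp]
    rcases A.flip_cases p with ⟨h1, -⟩ | ⟨q, hq, h1, h2⟩
    · rw [h1]
    · rw [h1, h2, M.flip_flip, htσ (A.τ q), htab _ (A.isDeleted_τ hq), A.τ_τ]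

end Cycles

end VertexSum

end HalfEdgeGraph

/-! ### Connectivity of vertex sums -/

namespace HalfEdgeGraph

/-- Every part of the graph is connected and stays connected when one of its vertices is
deleted. -/
def Biconnected {X W K : Type*} (M : HalfEdgeGraph X W) (κ : W → K) : Prop :=
  ∀ B : Set W, B.Subsingleton → ∀ c d, κ c = κ d → c ∉ B → d ∉ B →
    Relation.ReflTransGen (fun c d => M.Adj c d ∧ c ∉ B ∧ d ∉ B) c d

theorem Adj.symm {X W : Type*} {M : HalfEdgeGraph X W} {c d : W} (h : M.Adj c d) : M.Adj d c := by
  obtain ⟨p, rfl, rfl⟩ := h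
  exact ⟨M.flip p, rfl, by rw [M.flip_flip]⟩

namespace VertexSum

variable {X W K X' W' K' : Type*} {M : HalfEdgeGraph X W} {κ : W → K}
  {M' : HalfEdgeGraph X' W'} {κ' : W' → K'} (A : VertexSum M κ M' κ')

theorem vert_flip_ne' (A : VertexSum M κ M' κ') (p : X') : M'.vert (M'.flip p) ≠ M'.vert p := by
  intro h
  have h1 : M.vert (A.ι (M'.flip p)) = M.vert (A.ι p) := by rw [A.vert_ι, A.vert_ι, h]
  rcases A.flip_cases p with ⟨h2, -⟩ | ⟨q, hq, h2, h3⟩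
  · rw [h2] at h1; exact A.vert_flip_ne _ h1
  · have h4 := congrArg κ h1
    rw [h2, h3, A.κ_flip, A.κ_flip] at h4
    rcases hq with hq | hq
    · rw [hq, A.vert_τ_of_a q hq] at h4; exact A.κ_ne h4.symm
    · rw [hq, A.vert_τ_of_b q hq] at h4; exact A.κ_ne h4

/-- Reachability in the vertex sum outside a set of vertices. -/
abbrev Reach (_ : VertexSum M κ M' κ') (B : Set W') : W' → W' → Prop :=
  Relation.ReflTransGen (fun c d => M'.Adj c d ∧ c ∉ B ∧ d ∉ B)

theorem Reach.symm {B : Set W'} {c d : W'} (h : A.Reach B c d) : A.Reach B d c := by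
  have : Std.Symm fun c d => M'.Adj c d ∧ c ∉ B ∧ d ∉ B :=
    ⟨fun _ _ h => ⟨h.1.symm, h.2.2, h.2.1⟩⟩
  exact Relation.ReflTransGen.stdSymm.symm _ _ h

theorem adj_of_adj {c d : W'} (h : M.Adj (A.j c) (A.j d)) : M'.Adj c d := by
  obtain ⟨p, hp, hp'⟩ := h
  have hd : ∀ {p w}, M.vert p = A.j w → ¬ A.IsDeleted p := by
    intro p w h
    rw [← A.mem_range, A.mem_range_ι, h]
    exact (A.mem_range_j _).1 ⟨w, rfl⟩
  obtain ⟨p, rfl⟩ := A.exists_ι (hd hp)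
  refine ⟨p, A.j_injective ?_, A.j_injective ?_⟩
  · rw [← A.vert_ι, hp]
  · rw [← A.vert_ι, A.flip_ι' (hd hp'), hp']

/-- A path of `M` that avoids `a` and `b` is a path of the vertex sum. -/
theorem reach_of_path {B : Set W'} {N : Set W} {c : W'}
    (hN : ∀ w, κ w = κ (A.j c) → w ∉ N → ∃ w', A.j w' = w ∧ w' ∉ B) {w : W}
    (h : Relation.ReflTransGen (fun c d => M.Adj c d ∧ c ∉ N ∧ d ∉ N) (A.j c) w) :
    κ w = κ (A.j c) ∧ ∀ w', A.j w' = w → A.Reach B c w' := by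
  induction h with
  | refl =>
    refine ⟨rfl, fun w' h => ?_⟩
    rw [A.j_injective h]
  | @tail d e _ h ih =>
    obtain ⟨h1, hd, he⟩ := h
    have hk : κ e = κ (A.j c) := by
      obtain ⟨p, rfl, rfl⟩ := h1
      rw [A.κ_flip, ih.1]
    refine ⟨hk, ?_⟩
    rintro e' rfl
    obtain ⟨d', rfl, hd'⟩ := hN d ih.1 hd
    obtain ⟨e'', he'', he'⟩ := hN _ hk he
    rw [A.j_injective he''] at he'
    exact (ih.2 d' rfl).tail ⟨A.adj_of_adj h1, hd', he'⟩

/-- If the deleted vertices do not lie in the part of `b`, then a path of `M` through `a` can be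
rerouted through the part of `b`. -/
theorem reach_of_path_through_a (hM : M.Biconnected κ) {B : Set W'}
    (hB : ∀ w ∈ B, κ (A.j w) ≠ κ A.b) {c : W'} (hc : κ (A.j c) = κ A.a) {w : W}
    (h : Relation.ReflTransGen (fun c d => M.Adj c d ∧ c ∉ A.j '' B ∧ d ∉ A.j '' B) (A.j c) w) :
    κ w = κ A.a ∧ (∀ w', A.j w' = w → A.Reach B c w') ∧
      (w = A.a → ∀ d, κ (A.j d) = κ A.b → A.Reach B c d) := by
  have hb : ∀ d, κ (A.j d) = κ A.b → ∀ e, κ (A.j e) = κ A.b → A.Reach B d e := by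
    intro d hd e he
    have hne : ∀ w, A.j w ≠ A.b := fun w => ((A.mem_range_j _).1 ⟨w, rfl⟩).2
    refine (A.reach_of_path (N := {A.b}) ?_
      (hM {A.b} Set.subsingleton_singleton _ _ (hd.trans he.symm) (hne _) (hne _))).2 e rfl
    intro w hw hwb
    obtain ⟨w', rfl⟩ := (A.mem_range_j w).2
      ⟨fun h => A.κ_ne ((congrArg κ h).symm.trans (hw.trans hd)), hwb⟩
    exact ⟨w', rfl, fun h => hB _ h (hw.trans hd)⟩
  induction h with
  | refl =>
    refine ⟨hc, fun w' h => ?_, fun h => ?_⟩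
    · rw [A.j_injective h]
    · exact absurd h ((A.mem_range_j _).1 ⟨c, rfl⟩).1
  | @tail d e _ h ih =>
    obtain ⟨⟨p, rfl, rfl⟩, hd, he⟩ := h
    obtain ⟨ih1, ih2, ih3⟩ := ih
    have hk : κ (M.vert (M.flip p)) = κ A.a := by rw [A.κ_flip, ih1]
    have hnb : ∀ {p}, κ (M.vert p) = κ A.a → M.vert p ≠ A.b := fun h h' =>
      A.κ_ne (by rw [← h, h'])
    by_cases hpa : M.vert p = A.a
    · -- the path leaves `a`
      have hpd : A.IsDeleted p := Or.inl hpa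
      refine ⟨hk, ?_, fun h => absurd (h.trans hpa.symm) (A.vert_flip_ne p)⟩
      intro e' he'
      obtain ⟨p₁, hp₁⟩ := A.exists_ι (A.not_isDeleted_flip hpd)
      have hm := A.flip_merged hpd hp₁
      have hg : κ (A.j (M'.vert (M'.flip p₁))) = κ A.b := by
        rw [← A.vert_ι, hm, A.κ_τ_of_a hpa]
      have he1 : M'.vert p₁ = e' := A.j_injective (by rw [← A.vert_ι, hp₁, he'])
      refine (ih3 hpa _ hg).tail ⟨⟨M'.flip p₁, rfl, by rw [M'.flip_flip, he1]⟩,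
        fun h => hB _ h hg, fun h => he ⟨e', h, he'⟩⟩
    · have hpd : ¬ A.IsDeleted p := fun h => h.elim hpa (hnb ih1)
      obtain ⟨p, rfl⟩ := A.exists_ι hpd
      have hp' := (A.vert_ι p).symm
      refine ⟨hk, ?_, ?_⟩
      · rintro e' he'
        refine (ih2 _ hp').tail ⟨A.adj_of_adj ⟨A.ι p, A.vert_ι p, he'.symm⟩,
          fun h => hd ⟨_, h, hp'⟩, fun h => he ⟨_, h, he'⟩⟩
      · -- the path arrives at `a`
        intro ha d hdb
        have hm := A.flip_merged (p := p) (Or.inl ha) (M.flip_flip _).symm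
        have hg : κ (A.j (M'.vert (M'.flip p))) = κ A.b := by
          rw [← A.vert_ι, hm, A.κ_τ_of_a ha]
        exact ((ih2 _ hp').tail ⟨⟨p, rfl, rfl⟩, fun h => hd ⟨_, h, hp'⟩,
          fun h => hB _ h hg⟩).trans (hb _ hg _ hdb)

theorem reach_of_disjoint (hM : M.Biconnected κ) {B : Set W'} (hBs : B.Subsingleton)
    (hB : ∀ w ∈ B, κ (A.j w) ≠ κ A.b) {c d : W'} (h : κ' c = κ' d) (hc : c ∉ B) (hd : d ∉ B) :
    A.Reach B c d := by
  have hBs' : (A.j '' B).Subsingleton := hBs.image _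
  have hmem : ∀ {w}, w ∉ B → A.j w ∉ A.j '' B := fun h => by rwa [A.j_injective.mem_set_image]
  have hne : ∀ w, A.j w ≠ A.a ∧ A.j w ≠ A.b := fun w => (A.mem_range_j _).1 ⟨w, rfl⟩
  have key : ∀ {c d}, κ (A.j c) = κ A.a → (κ (A.j d) = κ A.a ∨ κ (A.j d) = κ A.b) → c ∉ B →
      d ∉ B → A.Reach B c d := by
    rintro c d h1 (h2 | h2) hc hd
    · exact (A.reach_of_path_through_a hM hB h1
        (hM _ hBs' _ _ (h1.trans h2.symm) (hmem hc) (hmem hd))).2.1 d rfl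
    · have ha : A.a ∉ A.j '' B := fun ⟨w, _, hw⟩ => (hne w).1 hw
      exact (A.reach_of_path_through_a hM hB h1 (hM _ hBs' _ _ h1 (hmem hc) ha)).2.2 rfl d h2
  by_cases hca : κ (A.j c) = κ A.a
  · refine key hca ?_ hc hd
    rcases (A.κ'_eq_iff c d).1 h with h | h
    · exact Or.inl (h.symm.trans hca)
    · exact h.2
  by_cases hda : κ (A.j d) = κ A.a
  · refine Reach.symm A (key hda ?_ hd hc)
    rcases (A.κ'_eq_iff c d).1 h with h | h
    · exact Or.inl (h.trans hda)
    · exact h.1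
  have hcd : κ (A.j c) = κ (A.j d) := by
    rcases (A.κ'_eq_iff c d).1 h with h | h
    · exact h
    · exact (h.1.resolve_left hca).trans (h.2.resolve_left hda).symm
  by_cases hcb : κ (A.j c) = κ A.b
  · refine (A.reach_of_path (N := {A.b}) ?_
      (hM {A.b} Set.subsingleton_singleton _ _ hcd (hne _).2 (hne _).2)).2 d rfl
    intro w hw hwb
    obtain ⟨w', rfl⟩ := (A.mem_range_j w).2
      ⟨fun h => hca (hw.symm.trans (congrArg κ h)), hwb⟩
    exact ⟨w', rfl, fun h => hB _ h (hw.trans hcb)⟩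
  · refine (A.reach_of_path (N := A.j '' B) ?_
      (hM _ hBs' _ _ hcd (hmem hc) (hmem hd))).2 d rfl
    intro w hw hwB
    obtain ⟨w', rfl⟩ := (A.mem_range_j w).2
      ⟨fun h => hca (hw.symm.trans (congrArg κ h)), fun h => hcb (hw.symm.trans (congrArg κ h))⟩
    exact ⟨w', rfl, fun h => hwB ⟨w', h, rfl⟩⟩

theorem biconnected (A : VertexSum M κ M' κ') (hM : M.Biconnected κ) : M'.Biconnected κ' := by
  intro B hB c d h hc hd
  by_cases hb : ∀ w ∈ B, κ (A.j w) ≠ κ A.b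
  · exact A.reach_of_disjoint hM hB hb h hc hd
  · push Not at hb
    obtain ⟨w, hw, hwb⟩ := hb
    refine A.symm.reach_of_disjoint hM hB (fun w' hw' h' => ?_) h hc hd
    rw [hB hw' hw] at h'
    exact A.κ_ne (h'.symm.trans hwb)

end VertexSum

end HalfEdgeGraph

/-! ### The cyclic order of the merged edges -/

/-- First return: a permutation `φ` of a finite set moves each element of `D` until it is
in `D` again. -/
theorem Equiv.Perm.exists_firstReturn {X : Type*} [Finite X] (φ : Equiv.Perm X) (D : Set X) :
    ∃ r : X → X, Set.InjOn r D ∧ ∀ y ∈ D, r y ∈ D ∧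
      ∃ n : ℕ, r y = (φ ^ (n + 1)) y ∧ ∀ i : ℕ, 0 < i → i ≤ n → (φ ^ i) y ∉ D := by
  classical
  have hex : ∀ y ∈ D, ∃ n : ℕ, (φ ^ (n + 1)) y ∈ D := fun y hy =>
    ⟨orderOf φ - 1, by
      have : 0 < orderOf φ := orderOf_pos φ
      rwa [Nat.sub_add_cancel this, pow_orderOf_eq_one]⟩
  choose! n hn using fun y (hy : y ∈ D) => (⟨Nat.find (hex y hy), Nat.find_spec (hex y hy),
    fun i h0 hi => by
      obtain ⟨i, rfl⟩ := Nat.exists_eq_succ_of_ne_zero h0.ne'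
      exact Nat.find_min (hex y hy) hi⟩ :
    ∃ n : ℕ, (φ ^ (n + 1)) y ∈ D ∧ ∀ i : ℕ, 0 < i → i ≤ n → (φ ^ i) y ∉ D)
  refine ⟨fun y => (φ ^ (n y + 1)) y, ?_, fun y hy => ⟨(hn y hy).1, n y, rfl, (hn y hy).2⟩⟩
  have key : ∀ y ∈ D, ∀ y' ∈ D, n y ≤ n y' → (φ ^ (n y + 1)) y = (φ ^ (n y' + 1)) y' →
      y = y' := by
    intro y hy y' hy' hle h
    obtain ⟨k, hk⟩ := Nat.exists_eq_add_of_le hle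
    rw [show n y' + 1 = (n y + 1) + k by omega, pow_add φ (n y + 1) k, Equiv.Perm.mul_apply] at h
    have h1 := (φ ^ (n y + 1)).injective h
    rcases Nat.eq_zero_or_pos k with rfl | hk0
    · simpa using h1
    · exact absurd (h1 ▸ hy) ((hn y' hy').2 k hk0 (by omega))
  intro y hy y' hy' h
  rcases le_total (n y) (n y') with hle | hle
  · exact key y hy y' hy' hle h
  · exact (key y' hy' y hy hle h.symm).symm

theorem Equiv.Perm.SameCycle.of_semiconj {X Y : Type*} {σ : Equiv.Perm X} {f : Equiv.Perm Y}
    {g : Y → X} (hg : ∀ y, σ (g y) = g (f y)) {x y : Y} (h : f.SameCycle x y) :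
    σ.SameCycle (g x) (g y) := by
  have hn : ∀ (n : ℕ) x, (σ ^ n) (g x) = g ((f ^ n) x) := by
    intro n
    induction n with
    | zero => intro x; rfl
    | succ n ih => intro x; rw [pow_succ, pow_succ, Equiv.Perm.mul_apply, Equiv.Perm.mul_apply,
        hg, ih]
  obtain ⟨n | n, rfl⟩ := h
  · exact ⟨n, by simpa using hn n x⟩
  · refine ⟨Int.negSucc n, ?_⟩
    rw [zpow_negSucc, zpow_negSucc, Equiv.Perm.inv_eq_iff_eq, hn, ← Equiv.Perm.mul_apply,
      mul_inv_cancel, Equiv.Perm.one_apply]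

namespace HalfEdgeGraph

namespace VertexSum

variable {X W K X' W' K' : Type*} {M : HalfEdgeGraph X W} {κ : W → K}
  {M' : HalfEdgeGraph X' W'} {κ' : W' → K'} (A : VertexSum M κ M' κ')

/-- Every even set of edges at `b` is the trace at `b` of a cycle in the part of `b`. -/
theorem exists_cycle_extending [Finite X] [Finite W] (hM : M.Biconnected κ) (ζ : X → ZMod 2)
    (hζ : fibreSum M.vert ζ A.b = 0) :
    ∃ y : X → ZMod 2, M.IsCycle y ∧ (∀ p, κ (M.vert p) ≠ κ A.b → y p = 0) ∧
      ∀ p, M.vert p = A.b → y p = ζ p := by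
  classical
  have := Fintype.ofFinite X
  have := Fintype.ofFinite W
  let x : X → ZMod 2 := fun p =>
    if M.vert p = A.b then ζ p else if M.vert (M.flip p) = A.b then ζ (M.flip p) else 0
  have hxb : ∀ p, M.vert p = A.b → x p = ζ p := fun p hp => by simp [x, hp]
  have hx0 : ∀ p, κ (M.vert p) ≠ κ A.b → x p = 0 := by
    intro p hp
    have h1 : M.vert p ≠ A.b := fun h => hp (by rw [h])
    have h2 : M.vert (M.flip p) ≠ A.b := fun h => hp (by rw [← h, A.κ_flip])
    simp [x, h1, h2]
  have hxf : ∀ p, x (M.flip p) = x p := by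
    intro p
    have h := A.vert_flip_ne p
    by_cases h1 : M.vert p = A.b
    · have h2 : M.vert (M.flip p) ≠ A.b := fun h2 => h (h2.trans h1.symm)
      simp [x, h1, h2, M.flip_flip]
    · by_cases h2 : M.vert (M.flip p) = A.b
      · simp [x, h1, h2]
      · simp [x, h1, h2, M.flip_flip]
  have hxsb : fibreSum M.vert x A.b = 0 := by
    rw [← hζ]
    exact fibreSum_congr _ _ _ _ hxb
  have hsum : ∑ w, fibreSum M.vert x w = 0 := by
    rw [sum_fibreSum]
    exact sum_eq_zero_of_flip (M := M) (fun p h => A.vert_flip_ne p (by rw [h])) hxf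
  obtain ⟨y, h1, h2, h3⟩ := exists_join (M := M) {w | κ w = κ A.b ∧ w ≠ A.b}
    (fun c hc d hd => by
      have h := hM {A.b} Set.subsingleton_singleton c d (hc.1.trans hd.1.symm) hc.2 hd.2
      suffices ∀ e, Relation.ReflTransGen
          (fun c d => M.Adj c d ∧ c ∉ ({A.b} : Set W) ∧ d ∉ ({A.b} : Set W)) c e →
          κ e = κ A.b ∧ Relation.ReflTransGen (fun c d => M.Adj c d ∧
            c ∈ {w | κ w = κ A.b ∧ w ≠ A.b} ∧ d ∈ {w | κ w = κ A.b ∧ w ≠ A.b}) c e from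
        (this d h).2
      intro e he
      induction he with
      | refl => exact ⟨hc.1, .refl⟩
      | @tail e f _ hef ih =>
        obtain ⟨⟨p, rfl, rfl⟩, h1, h2⟩ := hef
        have hk := (A.κ_flip p).trans ih.1
        exact ⟨hk, ih.2.tail ⟨⟨p, rfl, rfl⟩, ⟨ih.1, h1⟩, ⟨hk, h2⟩⟩⟩)
    (fibreSum M.vert x) (fun w hw => by
      by_cases hb : w = A.b
      · rw [hb, hxsb]
      · refine fibreSum_eq_zero _ _ _ fun p hp => hx0 p fun hk => hw ⟨by rw [← hp, hk], hb⟩)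
    hsum
  refine ⟨x + y, ⟨fun p => by simp [hxf, h1], fun w => ?_⟩, fun p hp => ?_, fun p hp => ?_⟩
  · rw [map_add, h3]
    exact CharTwo.add_self_eq_zero _
  · rw [Pi.add_apply, hx0 p hp, h2 p fun h => hp h.1, add_zero]
  · rw [Pi.add_apply, hxb p hp, h2 p fun h => h.2 hp, add_zero]

/-- A set of faces of the vertex sum, as a function on the half-edges of `M` that are not
deleted. -/
noncomputable def ext (s : X' → ZMod 2) : X → ZMod 2 :=
  Function.extend A.ι s 0

theorem ext_ι (s : X' → ZMod 2) (p : X') : A.ext s (A.ι p) = s p :=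
  A.ι_injective.extend_apply _ _ _

theorem fibreSum_τ [Finite X] (z : X → ZMod 2) :
    fibreSum M.vert (z ∘ A.τ) A.b = fibreSum M.vert z A.a :=
  fibreSum_comp _ _ A.τ (Function.LeftInverse.injective A.τ_τ) _ _
    (fun p => ⟨fun h => by rw [← A.τ_τ p]; exact A.vert_τ_of_a _ h, A.vert_τ_of_b p⟩)
    (fun p _ => ⟨A.τ p, A.τ_τ p⟩) z

/-- Every even set of merged edges is the boundary of a set of faces of the vertex sum, as far as
merged edges are concerned. -/
theorem exists_faces_of_even [Finite X] [Finite X'] [Finite W] (hM : M.Biconnected κ)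
    {σ' : Equiv.Perm X'} (h : M'.HomologyTrivial σ') (ζ : X → ZMod 2)
    (hζ : fibreSum M.vert ζ A.a = 0) :
    ∃ s : X' → ZMod 2, (∀ p, s (σ' (M'.flip p)) = s p) ∧
      ∀ q, M.vert q = A.a → ζ q = A.ext s (M.flip q) + A.ext s (M.flip (A.τ q)) := by
  obtain ⟨y, hy1, hy2, hy3⟩ := A.symm.exists_cycle_extending hM ζ hζ
  obtain ⟨y', hy1', hy2', hy3'⟩ := A.exists_cycle_extending hM (ζ ∘ A.τ)
    ((A.fibreSum_τ ζ).trans hζ)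
  have hya : ∀ q, M.vert q = A.a → (y + y') q = ζ q ∧ (y + y') (A.τ q) = ζ q := by
    intro q hq
    have hb := A.vert_τ_of_a q hq
    refine ⟨?_, ?_⟩
    · rw [Pi.add_apply, hy3 q hq, hy2' q (by rw [hq]; exact A.κ_ne), add_zero]
    · rw [Pi.add_apply, hy3' _ hb, hy2 _ (by rw [hb]; exact A.κ_ne.symm), zero_add,
        Function.comp, A.τ_τ]
  obtain ⟨s, hs1, hs2⟩ := h _ (A.isCycle_comp_ι (hy1.add hy1') (by
    rintro q (hq | hq)
    · rw [(hya q hq).1, (hya q hq).2]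
    · have ha := A.vert_τ_of_b q hq
      have h1 := hya _ ha
      rw [A.τ_τ] at h1
      rw [h1.1, h1.2]))
  refine ⟨s, hs1, fun q hq => ?_⟩
  obtain ⟨p, hp⟩ := A.exists_ι (A.not_isDeleted_flip (Or.inl hq))
  have hm := A.flip_merged (Or.inl hq) hp
  have h1 := hs2 p
  rw [Function.comp, hp, (hy1.add hy1').flip, (hya q hq).1] at h1
  rw [h1, ← hp, ← hm, A.ext_ι, A.ext_ι]

/-- Following the faces of the vertex sum through the part of `a`: there is a permutation `ρ` of
the half-edges at `a` such that each face of the vertex sum that enters the part of `a` through the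
merged edge of `q` leaves this part through the merged edge of `ρ q`. -/
theorem exists_traversal [Finite X] [Finite X'] {σ' : Equiv.Perm X'} (hσ' : M'.IsRotation σ') :
    ∃ ρ : Equiv.Perm {q // M.vert q = A.a}, ∀ s : X' → ZMod 2,
      (∀ p, s (σ' (M'.flip p)) = s p) →
      ∀ q, A.ext s (M.flip (ρ q).1) = A.ext s (M.flip (A.τ q.1)) := by
  have hex : ∀ q : {q // A.IsDeleted q}, ∃ p, A.ι p = M.flip q.1 := fun q =>
    A.exists_ι (A.not_isDeleted_flip q.2)
  choose e he using hex
  let φ : Equiv.Perm X' :=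
    (Function.Involutive.toPerm M'.flip M'.flip_flip).trans σ'
  have hφ : ∀ p, φ p = σ' (M'.flip p) := fun p => rfl
  obtain ⟨r, hr1, hr2⟩ := φ.exists_firstReturn {p | A.IsDeleted (M.flip (A.ι p))}
  have hτ : ∀ q : {q // M.vert q = A.a}, A.IsDeleted (A.τ q.1) := fun q =>
    A.isDeleted_τ (Or.inl q.2)
  let y : {q // M.vert q = A.a} → X' := fun q => e ⟨A.τ q.1, hτ q⟩
  have hy : ∀ q, A.ι (y q) = M.flip (A.τ q.1) := fun q => he _
  have hyD : ∀ q, y q ∈ {p | A.IsDeleted (M.flip (A.ι p))} := by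
    intro q
    rw [Set.mem_ofPred_eq, hy, M.flip_flip]
    exact hτ q
  have hκ : ∀ p, κ (M.vert (A.ι (σ' p))) = κ (M.vert (A.ι p)) := fun p => by
    rw [A.vert_ι, A.vert_ι, hσ'.vert_apply]
  -- after entering the part of `a` a face stays there until it meets a merged edge again
  have hstay : ∀ q (n : ℕ), (∀ i : ℕ, 0 < i → i ≤ n →
      (φ ^ i) (y q) ∉ {p | A.IsDeleted (M.flip (A.ι p))}) →
      κ (M.vert (A.ι ((φ ^ (n + 1)) (y q)))) = κ A.a := by
    intro q n
    induction n with
    | zero =>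
      intro _
      rw [zero_add, pow_one, hφ, hκ, A.flip_merged (hτ q) (hy q), A.τ_τ, A.κ_flip, q.2]
    | succ n ih =>
      intro h
      have h1 := h (n + 1) n.succ_pos le_rfl
      rw [pow_succ', Equiv.Perm.mul_apply, hφ, hκ, A.flip_ι' h1, A.κ_flip]
      exact ih fun i h0 hi => h i h0 (hi.trans n.le_succ)
  have hra : ∀ q, M.vert (M.flip (A.ι (r (y q)))) = A.a := by
    intro q
    obtain ⟨h1, n, hn, h2⟩ := hr2 _ (hyD q)
    refine h1.resolve_right fun h3 => A.κ_ne ?_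
    rw [← hstay q n h2, ← hn, ← A.κ_flip, h3]
  have hinj : Function.Injective fun q => (⟨M.flip (A.ι (r (y q))), hra q⟩ :
      {q // M.vert q = A.a}) := by
    intro q q' h
    have h1 : M.flip (A.ι (r (y q))) = M.flip (A.ι (r (y q'))) := congrArg Subtype.val h
    have h2 := hr1 (hyD q) (hyD q')
      (A.ι_injective (Function.LeftInverse.injective M.flip_flip h1))
    have h3 : M.flip (A.τ q.1) = M.flip (A.τ q'.1) := by rw [← hy, ← hy, h2]
    exact Subtype.ext (Function.LeftInverse.injective A.τ_τ
      (Function.LeftInverse.injective M.flip_flip h3))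
  refine ⟨Equiv.ofBijective _ (Finite.injective_iff_bijective.1 hinj), fun s hs q => ?_⟩
  have hsn : ∀ (n : ℕ) p, s ((φ ^ n) p) = s p := by
    intro n
    induction n with
    | zero => intro p; rfl
    | succ n ih => intro p; rw [pow_succ', Equiv.Perm.mul_apply, hφ, hs, ih]
  obtain ⟨-, n, hn, -⟩ := hr2 _ (hyD q)
  rw [Equiv.ofBijective_apply, M.flip_flip, A.ext_ι, hn, hsn, ← hy, A.ext_ι]

/-- If the surface of the vertex sum is a sphere, then the permutation `ρ` from `exists_traversal`
has only one cycle. Otherwise take two half-edges in different cycles: there is a set of faces whose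
boundary contains exactly two merged edges, one in each of the cycles; but the boundary of a set of
faces contains evenly many merged edges from each cycle of `ρ`. -/
theorem sameCycle_traversal [Finite X] [Finite X'] [Finite W] (hM : M.Biconnected κ)
    {σ' : Equiv.Perm X'} (h : M'.HomologyTrivial σ') {ρ : Equiv.Perm {q // M.vert q = A.a}}
    (hρ : ∀ s : X' → ZMod 2, (∀ p, s (σ' (M'.flip p)) = s p) →
      ∀ q, A.ext s (M.flip (ρ q).1) = A.ext s (M.flip (A.τ q.1)))
    (q q' : {q // M.vert q = A.a}) : ρ.SameCycle q q' := by
  classical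
  have := Fintype.ofFinite {q // M.vert q = A.a}
  by_contra hne
  have hqq : q.1 ≠ q'.1 := fun h => hne (by rw [Subtype.ext h])
  obtain ⟨s, hs1, hs2⟩ := A.exists_faces_of_even hM h (Pi.single q.1 1 + Pi.single q'.1 1) (by
    rw [map_add, fibreSum_single, fibreSum_single, q.2, q'.2]
    simp [CharTwo.add_self_eq_zero])
  let u : {q // M.vert q = A.a} → ZMod 2 := fun x => A.ext s (M.flip x.1)
  have hu : ∀ x : {q // M.vert q = A.a}, (if x = q then 1 else 0) + (if x = q' then 1 else 0)
      = u x + u (ρ x) := by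
    intro x
    have h1 := hs2 x.1 x.2
    rw [← hρ s hs1 x] at h1
    simpa [Pi.single_apply, Subtype.ext_iff] using h1
  have h1 : ∑ x with ρ.SameCycle q x, (u x + u (ρ x)) = 0 := by
    have h2 : ∑ x with ρ.SameCycle q x, u (ρ x) = ∑ x with ρ.SameCycle q x, u x :=
      Finset.sum_equiv ρ (fun x => by simp) (fun _ _ => rfl)
    rw [Finset.sum_add_distrib, h2]
    exact CharTwo.add_self_eq_zero _
  rw [← Finset.sum_congr rfl fun x _ => hu x, Finset.sum_add_distrib] at h1
  simp [hne, Equiv.Perm.SameCycle.refl] at h1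

end VertexSum

end HalfEdgeGraph

/-! ### Lifting a rotation system along a vertex sum -/

namespace HalfEdgeGraph

namespace VertexSum

variable {X W K X' W' K' : Type*} {M : HalfEdgeGraph X W} {κ : W → K}
  {M' : HalfEdgeGraph X' W'} {κ' : W' → K'} (A : VertexSum M κ M' κ')

/-- The map `τ` as a permutation. -/
def τPerm : Equiv.Perm X := ⟨A.τ, A.τ, A.τ_τ, A.τ_τ⟩

open Classical in
/-- The rotation system of `M` that is given by a rotation system `σ'` of the vertex sum and by the
inverse of a permutation `ρ` of the half-edges at `a`. -/
noncomputable def extendRotation (σ' : Equiv.Perm X') (ρ : Equiv.Perm {q // M.vert q = A.a}) :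
    Equiv.Perm X :=
  σ'.viaEmbedding ⟨A.ι, A.ι_injective⟩ * (Equiv.Perm.ofSubtype ρ.symm *
    (A.τPerm * Equiv.Perm.ofSubtype ρ *
      A.τPerm⁻¹))

section

variable (σ' : Equiv.Perm X') (ρ : Equiv.Perm {q // M.vert q = A.a})

open Classical in
theorem ofSubtype_of_ne {ρ : Equiv.Perm {q // M.vert q = A.a}} {x : X} (h : M.vert x ≠ A.a) :
    Equiv.Perm.ofSubtype ρ x = x :=
  Equiv.Perm.ofSubtype_apply_of_not_mem ρ h

theorem extendRotation_ι (p : X') : A.extendRotation σ' ρ (A.ι p) = A.ι (σ' p) := by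
  classical
  have h := A.not_isDeleted_ι p
  have ha : M.vert (A.ι p) ≠ A.a := fun h' => h (Or.inl h')
  have hb : M.vert (A.τ (A.ι p)) ≠ A.a := fun h' =>
    h (Or.inr (by rw [← A.τ_τ (A.ι p)]; exact A.vert_τ_of_a _ h'))
  have h1 : A.τPerm⁻¹ (A.ι p) = A.τ (A.ι p) := rfl
  have h2 : A.τPerm (A.τ (A.ι p)) = A.ι p := A.τ_τ _
  simp only [extendRotation, Equiv.Perm.mul_apply]
  rw [h1, A.ofSubtype_of_ne hb, h2,
    A.ofSubtype_of_ne ha]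
  exact Equiv.Perm.viaEmbedding_apply σ' ⟨A.ι, A.ι_injective⟩ p

theorem viaEmbedding_of_isDeleted {q : X} (hq : A.IsDeleted q) :
    σ'.viaEmbedding ⟨A.ι, A.ι_injective⟩ q = q :=
  Equiv.Perm.viaEmbedding_apply_of_notMem _ _ _ fun h => A.mem_range.1 h hq

theorem extendRotation_a (q : {q // M.vert q = A.a}) :
    A.extendRotation σ' ρ q = (ρ.symm q : {q // M.vert q = A.a}) := by
  classical
  have hb : M.vert (A.τ q.1) ≠ A.a := fun h' => A.a_ne_b (by rw [← h', A.vert_τ_of_a _ q.2])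
  have h1 : A.τPerm⁻¹ q.1 = A.τ q.1 := rfl
  have h2 : A.τPerm (A.τ q.1) = q.1 := A.τ_τ _
  simp only [extendRotation, Equiv.Perm.mul_apply]
  rw [h1, A.ofSubtype_of_ne hb, h2, Equiv.Perm.ofSubtype_apply_coe]
  exact A.viaEmbedding_of_isDeleted σ' (Or.inl (ρ.symm q).2)

theorem extendRotation_b (q : {q // M.vert q = A.a}) :
    A.extendRotation σ' ρ (A.τ q) = A.τ (ρ q : {q // M.vert q = A.a}) := by
  classical
  have hb : M.vert (A.τ (ρ q).1) ≠ A.a := fun h' =>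
    A.a_ne_b (by rw [← h', A.vert_τ_of_a _ (ρ q).2])
  have h1 : A.τPerm⁻¹ (A.τ q.1) = q.1 := A.τ_τ _
  have h2 : A.τPerm (ρ q).1 = A.τ (ρ q).1 := rfl
  simp only [extendRotation, Equiv.Perm.mul_apply]
  rw [h1, Equiv.Perm.ofSubtype_apply_coe, h2, A.ofSubtype_of_ne hb]
  exact A.viaEmbedding_of_isDeleted σ' (Or.inr (A.vert_τ_of_a _ (ρ q).2))

theorem exists_τ {p : X} (h : M.vert p = A.b) : ∃ q : {q // M.vert q = A.a}, A.τ q.1 = p :=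
  ⟨⟨A.τ p, A.vert_τ_of_b p h⟩, A.τ_τ p⟩

variable {σ' ρ}

theorem isRotation_extendRotation [Finite X] (hσ' : M'.IsRotation σ')
    (hρ : ∀ q q', ρ.SameCycle q q') : M.IsRotation (A.extendRotation σ' ρ) := by
  have hv : ∀ p, M.vert (A.extendRotation σ' ρ p) = M.vert p := by
    intro p
    by_cases h : A.IsDeleted p
    · rcases h with h | h
      · have := A.extendRotation_a σ' ρ ⟨p, h⟩
        rw [this, h]
        exact (ρ.symm ⟨p, h⟩).2
      · obtain ⟨q, rfl⟩ := A.exists_τ h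
        rw [A.extendRotation_b, A.vert_τ_of_a _ (ρ q).2, h]
    · obtain ⟨p, rfl⟩ := A.exists_ι h
      rw [A.extendRotation_ι, A.vert_ι, A.vert_ι, hσ'.vert_apply]
  intro p q
  constructor
  · intro h
    obtain ⟨n, rfl⟩ := h.exists_nat_pow_eq
    clear h
    induction n with
    | zero => rfl
    | succ n ih => rw [pow_succ', Equiv.Perm.mul_apply, hv, ih]
  · intro h
    by_cases hp : A.IsDeleted p
    · rcases hp with hp | hp
      · exact Equiv.Perm.SameCycle.of_semiconj (f := ρ⁻¹) (g := Subtype.val)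
          (A.extendRotation_a σ' ρ) (x := ⟨p, hp⟩) (y := ⟨q, h.symm.trans hp⟩)
          (Equiv.Perm.sameCycle_inv.2 (hρ _ _))
      · obtain ⟨p, rfl⟩ := A.exists_τ hp
        obtain ⟨q, rfl⟩ := A.exists_τ (h.symm.trans hp)
        exact Equiv.Perm.SameCycle.of_semiconj (g := fun q : {q // M.vert q = A.a} => A.τ q.1)
          (A.extendRotation_b σ' ρ) (hρ p q)
    · have hq : ¬ A.IsDeleted q := by rwa [IsDeleted, ← h]
      obtain ⟨p, rfl⟩ := A.exists_ι hp
      obtain ⟨q, rfl⟩ := A.exists_ι hq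
      refine Equiv.Perm.SameCycle.of_semiconj (g := A.ι) (A.extendRotation_ι σ' ρ)
        ((hσ' _ _).2 (A.j_injective ?_))
      rw [← A.vert_ι, ← A.vert_ι, h]

/-- The rotators at `a` and `b` are reverse to each other. -/
theorem extendRotation_τ (q : X) (hq : A.IsDeleted q) :
    A.extendRotation σ' ρ (A.τ (A.extendRotation σ' ρ q)) = A.τ q := by
  rcases hq with hq | hq
  · have := A.extendRotation_a σ' ρ ⟨q, hq⟩
    rw [this, A.extendRotation_b, Equiv.apply_symm_apply]
  · obtain ⟨q, rfl⟩ := A.exists_τ hq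
    rw [A.extendRotation_b, A.τ_τ, A.τ_τ, A.extendRotation_a, Equiv.symm_apply_apply]

end

/-- In the part of `a`, each cycle is a sum of boundaries of faces: complete the cycle to a cycle
of the vertex sum and take a set of faces there. -/
theorem exists_faces_of_isCycle [Finite X] [Finite X'] [Finite W] (hM : M.Biconnected κ)
    {σ' : Equiv.Perm X'} (h : M'.HomologyTrivial σ') {σ : Equiv.Perm X} (hrot : M.IsRotation σ)
    (hσ : ∀ p, σ (A.ι p) = A.ι (σ' p))
    (hext : ∀ s : X' → ZMod 2, (∀ p, s (σ' (M'.flip p)) = s p) →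
      ∀ q, M.vert q = A.a → A.ext s (M.flip (A.τ (σ q))) = A.ext s (M.flip q))
    {z : X → ZMod 2} (hz : M.IsCycle z) :
    ∃ s : X → ZMod 2, (∀ p, s (σ (M.flip p)) = s p) ∧
      ∀ p, κ (M.vert p) ≠ κ A.b → z p = s p + s (M.flip p) := by
  classical
  obtain ⟨y, hy1, hy2, hy3⟩ := A.exists_cycle_extending hM (z ∘ A.τ)
    ((A.fibreSum_τ z).trans (hz.sum _))
  let x : X → ZMod 2 := fun p => if κ (M.vert p) = κ A.b then 0 else z p
  have hx : M.IsCycle x := by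
    refine ⟨fun p => by simp only [x, A.κ_flip, hz.flip], fun w => ?_⟩
    by_cases hw : κ w = κ A.b
    · exact fibreSum_eq_zero _ _ _ fun p hp => by simp [x, hp, hw]
    · rw [← hz.sum w]
      exact fibreSum_congr _ _ _ _ fun p hp => by simp [x, hp, hw]
  have hxy : ∀ p, κ (M.vert p) ≠ κ A.b → (x + y) p = z p := by
    intro p hp
    simp [x, hp, hy2 p hp]
  have hxya : ∀ q, M.vert q = A.a → (x + y) (A.τ q) = z q := by
    intro q hq
    have hb := A.vert_τ_of_a q hq
    simp [x, hb, hy3 _ hb, A.τ_τ]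
  have hκa : ∀ q, M.vert q = A.a → κ (M.vert q) ≠ κ A.b := fun q hq => by
    rw [hq]; exact A.κ_ne
  obtain ⟨s', hs1, hs2⟩ := h _ (A.isCycle_comp_ι (hx.add hy1) (by
    rintro q (hq | hq)
    · rw [hxya q hq, hxy q (hκa q hq)]
    · have ha := A.vert_τ_of_b q hq
      have h1 := hxya _ ha
      rw [A.τ_τ] at h1
      rw [h1, hxy _ (hκa _ ha)]))
  have hs1' : ∀ p, s' (M'.flip p) = s' (σ' p) := fun p => by
    rw [← hs1 (M'.flip p), M'.flip_flip]
  let s : X → ZMod 2 := fun p => if κ (M.vert p) = κ A.b then 0 else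
    if M.vert p = A.a then A.ext s' (M.flip (A.τ p)) else A.ext s' p
  have hsa : ∀ q, M.vert q = A.a → s q = A.ext s' (M.flip (A.τ q)) := by
    intro q hq
    simp [s, hq, A.κ_ne]
  have hsι : ∀ p, κ (M.vert (A.ι p)) ≠ κ A.b → s (A.ι p) = s' p := by
    intro p hp
    have : M.vert (A.ι p) ≠ A.a := fun h => A.not_isDeleted_ι p (Or.inl h)
    simp [s, hp, this, A.ext_ι]
  have hnb : ∀ {p}, κ (M.vert p) ≠ κ A.b → A.IsDeleted p → M.vert p = A.a := fun hp h =>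
    h.resolve_right fun hb => hp (by rw [hb])
  refine ⟨s, ?_, ?_⟩
  · intro p
    by_cases hp : κ (M.vert p) = κ A.b
    · simp [s, hp, hrot.vert_apply, A.κ_flip]
    have hfp : κ (M.vert (M.flip p)) ≠ κ A.b := by rwa [A.κ_flip]
    by_cases hpd : A.IsDeleted p
    · have ha := hnb hp hpd
      obtain ⟨p₁, hp₁⟩ := A.exists_ι (A.not_isDeleted_flip hpd)
      rw [hsa p ha, ← hp₁, hσ, hsι, ← A.flip_merged hpd hp₁, A.ext_ι, hs1']
      rwa [← hσ, hrot.vert_apply, hp₁]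
    obtain ⟨p, rfl⟩ := A.exists_ι hpd
    by_cases hfd : A.IsDeleted (M.flip (A.ι p))
    · have ha := hnb hfp hfd
      rw [hsa _ ((hrot.vert_apply _).trans ha), hext s' hs1 _ ha, M.flip_flip, A.ext_ι,
        hsι p hp]
    · rw [← A.flip_ι' hfd, hσ, hsι, hsι p hp, hs1]
      rwa [← hσ, hrot.vert_apply, A.flip_ι' hfd]
  · have key : ∀ p, M.vert p = A.a → z p = s p + s (M.flip p) := by
      intro p ha
      have hpd : A.IsDeleted p := Or.inl ha
      have hp := hκa p ha
      obtain ⟨p₁, hp₁⟩ := A.exists_ι (A.not_isDeleted_flip hpd)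
      have h1 := hs2 p₁
      have hfp : κ (M.vert (M.flip p)) ≠ κ A.b := by rwa [A.κ_flip]
      rw [Function.comp, hp₁, hxy _ hfp, hz.flip] at h1
      rw [h1, hsa p ha, ← A.flip_merged hpd hp₁, A.ext_ι, ← hp₁, hsι, add_comm]
      rwa [hp₁]
    intro p hp
    by_cases hpd : A.IsDeleted p
    · exact key p (hnb hp hpd)
    obtain ⟨p, rfl⟩ := A.exists_ι hpd
    have hfp : κ (M.vert (M.flip (A.ι p))) ≠ κ A.b := by rwa [A.κ_flip]
    by_cases hfd : A.IsDeleted (M.flip (A.ι p))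
    · have h1 := key _ (hnb hfp hfd)
      rw [M.flip_flip, hz.flip] at h1
      rw [h1, add_comm]
    · have h1 := hs2 p
      rw [Function.comp, hxy _ hp] at h1
      rw [h1, hsι p hp, ← A.flip_ι' hfd, hsι]
      rwa [A.flip_ι' hfd]

/-- If a vertex sum of biconnected graphs is embedded in the sphere, then the merged edges form a
bond. The cyclic order of this bond gives rotators at `a` and at `b` that are reverse to each
other, and with them the two graphs are embedded in the sphere, too. -/
theorem exists_rotation_of_homologyTrivial [Finite X] [Finite X'] [Finite W]
    (hM : M.Biconnected κ) {σ' : Equiv.Perm X'} (hrot : M'.IsRotation σ')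
    (h : M'.HomologyTrivial σ') :
    ∃ σ : Equiv.Perm X, M.IsRotation σ ∧ M.HomologyTrivial σ ∧
      (∀ p, σ (A.ι p) = A.ι (σ' p)) ∧ ∀ q, A.IsDeleted q → σ (A.τ (σ q)) = A.τ q := by
  classical
  obtain ⟨ρ, hρ⟩ := A.exists_traversal hrot
  have hσrot := A.isRotation_extendRotation hrot (A.sameCycle_traversal hM h hρ)
  refine ⟨A.extendRotation σ' ρ, hσrot, ?_, A.extendRotation_ι σ' ρ, A.extendRotation_τ⟩
  intro z hz
  obtain ⟨s₁, h1, h1'⟩ := A.exists_faces_of_isCycle hM h hσrot (A.extendRotation_ι σ' ρ)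
    (fun s hs q hq => by
      have h1 := A.extendRotation_a σ' ρ ⟨q, hq⟩
      rw [h1, ← hρ s hs, Equiv.apply_symm_apply]) hz
  obtain ⟨s₂, h2, h2'⟩ := A.symm.exists_faces_of_isCycle hM h hσrot (A.extendRotation_ι σ' ρ)
    (fun s hs q hq => by
      obtain ⟨q, rfl⟩ := A.exists_τ hq
      rw [A.extendRotation_b]
      change A.ext s (M.flip (A.τ (A.τ _))) = A.ext s _
      rw [A.τ_τ, hρ s hs]) hz
  refine ⟨fun p => if κ (M.vert p) = κ A.b then s₂ p else s₁ p, fun p => ?_, fun p => ?_⟩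
  · simp only [hσrot.vert_apply, A.κ_flip, h1, h2]
  · simp only [A.κ_flip]
    split_ifs with hp
    · exact h2' p fun h => A.κ_ne (h.symm.trans hp)
    · exact h1' p hp

end VertexSum

end HalfEdgeGraph

/-! ### The union of all link graphs -/

namespace TwoComplex

variable (C : TwoComplex.{u})

instance : Finite C.V := C.finite_V
instance : Finite C.E := C.finite_E
instance : Finite C.F := C.finite_F

/-- The incidences of a face with a half-edge. They are the half-edges of the disjoint union of all
link graphs: a face that traverses the edge `e` has one incidence with each of its halves. -/
abbrev Flag : Type u := {p : C.F × (C.E × Bool) // p.2.1 ∈ (C.face p.1).map Prod.fst}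

open Classical in
/-- The permutation of the darts of a face that maps each dart to the next one. -/
noncomputable def nextPerm (f : C.F) : Equiv.Perm (C.E × Bool) := (C.face f).formPerm

variable {C}

theorem nextPerm_eq {_ : DecidableEq (C.E × Bool)} (f : C.F) :
    C.nextPerm f = (C.face f).formPerm := by
  unfold nextPerm
  congr!

theorem nextPerm_mem_iff {f : C.F} {d : C.E × Bool} :
    C.nextPerm f d ∈ C.face f ↔ d ∈ C.face f := by
  classical
  exact List.formPerm_mem_iff_mem

theorem mem_map_iff {f : C.F} {h : C.E × Bool} :
    h.1 ∈ (C.face f).map Prod.fst ↔ h ∈ C.face f ∨ halfFlip h ∈ C.face f := by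
  obtain ⟨e, i⟩ := h
  simp only [List.mem_map]
  constructor
  · rintro ⟨⟨e', j⟩, hd, rfl⟩
    cases i <;> cases j <;> simp [halfFlip, hd]
  · rintro (h | h)
    · exact ⟨_, h, rfl⟩
    · exact ⟨_, h, rfl⟩

theorem halfFlip_notMem {f : C.F} {h : C.E × Bool} (hh : h ∈ C.face f) :
    halfFlip h ∉ C.face f := by
  intro h'
  have := List.inj_on_of_nodup_map (C.face_nodup f) h' hh rfl
  obtain ⟨e, i⟩ := h
  simp [halfFlip] at this

open Classical in
/-- The other half-edge at a traversal of the face `f`. -/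
noncomputable def flagFlip (f : C.F) (h : C.E × Bool) : C.E × Bool :=
  if h ∈ C.face f then halfFlip (C.nextPerm f h) else (C.nextPerm f).symm (halfFlip h)

theorem flagFlip_of_mem {f : C.F} {h : C.E × Bool} (hh : h ∈ C.face f) :
    flagFlip f h = halfFlip (C.nextPerm f h) := if_pos hh

theorem flagFlip_of_notMem {f : C.F} {h : C.E × Bool} (hh : h ∉ C.face f) :
    flagFlip f h = (C.nextPerm f).symm (halfFlip h) := if_neg hh

theorem symm_nextPerm_mem {f : C.F} {d : C.E × Bool} (h : d ∈ C.face f) :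
    (C.nextPerm f).symm d ∈ C.face f := by
  rwa [← nextPerm_mem_iff, Equiv.apply_symm_apply]

theorem flagFlip_mem_map {f : C.F} {h : C.E × Bool} (hh : h.1 ∈ (C.face f).map Prod.fst) :
    (flagFlip f h).1 ∈ (C.face f).map Prod.fst := by
  rw [mem_map_iff]
  by_cases hm : h ∈ C.face f
  · right
    rw [flagFlip_of_mem hm, Multigraph.halfFlip_halfFlip]
    exact nextPerm_mem_iff.2 hm
  · left
    rw [flagFlip_of_notMem hm]
    exact symm_nextPerm_mem ((mem_map_iff.1 hh).resolve_left hm)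

theorem flagFlip_flagFlip {f : C.F} {h : C.E × Bool} (hh : h.1 ∈ (C.face f).map Prod.fst) :
    flagFlip f (flagFlip f h) = h := by
  by_cases hm : h ∈ C.face f
  · have h1 := halfFlip_notMem (nextPerm_mem_iff.2 hm)
    rw [flagFlip_of_mem hm, flagFlip_of_notMem h1, Multigraph.halfFlip_halfFlip,
      Equiv.symm_apply_apply]
  · have h1 := symm_nextPerm_mem ((mem_map_iff.1 hh).resolve_left hm)
    rw [flagFlip_of_notMem hm, flagFlip_of_mem h1, Equiv.apply_symm_apply,
      Multigraph.halfFlip_halfFlip]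

variable (C)

/-- The disjoint union of all link graphs of `C`. -/
noncomputable def linkGraph : HalfEdgeGraph C.Flag (C.E × Bool) where
  flip p := ⟨(p.1.1, flagFlip p.1.1 p.1.2), flagFlip_mem_map p.2⟩
  vert p := p.1.2
  flip_flip p := Subtype.ext (Prod.ext rfl (flagFlip_flagFlip p.2))

/-- The link graphs of `C` have no loops, are connected, and stay connected when a vertex is
deleted. -/
structure LinkBiconnected : Prop where
  vert_flip_ne : ∀ p, C.linkGraph.vert (C.linkGraph.flip p) ≠ C.linkGraph.vert p
  biconnected : C.linkGraph.Biconnected C.graph.endpoint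

variable {C}

theorem endpoint_nextPerm {f : C.F} {d : C.E × Bool} (hd : d ∈ C.face f) :
    C.graph.endpoint (halfFlip (C.nextPerm f d)) = C.graph.endpoint d :=
  C.endpoint_nextDart hd

theorem endpoint_flip (p : C.Flag) : C.graph.endpoint (C.linkGraph.vert (C.linkGraph.flip p))
    = C.graph.endpoint (C.linkGraph.vert p) := by
  obtain ⟨⟨f, h⟩, hp⟩ := p
  change C.graph.endpoint (flagFlip f h) = C.graph.endpoint h
  by_cases hm : h ∈ C.face f
  · rw [flagFlip_of_mem hm, endpoint_nextPerm hm]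
  · have h1 := symm_nextPerm_mem ((mem_map_iff.1 hp).resolve_left hm)
    rw [flagFlip_of_notMem hm, ← endpoint_nextPerm h1, Equiv.apply_symm_apply,
      Multigraph.halfFlip_halfFlip]

/-- The incidence of the same face with the other half of the edge. -/
def flagSwap (p : C.Flag) : C.Flag := ⟨(p.1.1, halfFlip p.1.2), p.2⟩

theorem flagSwap_flagSwap (p : C.Flag) : flagSwap (flagSwap p) = p :=
  Subtype.ext (Prod.ext rfl (Multigraph.halfFlip_halfFlip _))

/-! ### Contraction as a vertex sum of link graphs -/

theorem deleteEdge_append (x : C.E) (l m : List (C.E × Bool)) :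
    C.deleteEdge x (l ++ m) = C.deleteEdge x l ++ C.deleteEdge x m := by
  simp [deleteEdge]

theorem deleteEdge_cons_of_ne {x : C.E} {d : C.E × Bool} (h : d.1 ≠ x) (l : List (C.E × Bool)) :
    C.deleteEdge x (d :: l) = (⟨d.1, h⟩, d.2) :: C.deleteEdge x l := by
  simp [deleteEdge, h]

theorem deleteEdge_cons_of_eq {x : C.E} {d : C.E × Bool} (h : d.1 = x) (l : List (C.E × Bool)) :
    C.deleteEdge x (d :: l) = C.deleteEdge x l := by
  simp [deleteEdge, h]

/-- The half-edge of `C` from which a half-edge of a contraction comes. -/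
def liftHalf {x : C.E} (h : {e : C.E // e ≠ x} × Bool) : C.E × Bool := (h.1.1, h.2)

theorem liftHalf_injective {x : C.E} : Function.Injective (liftHalf (C := C) (x := x)) := by
  rintro ⟨⟨e, he⟩, i⟩ ⟨⟨e', he'⟩, i'⟩ h
  simp only [liftHalf, Prod.mk.injEq] at h
  obtain ⟨rfl, rfl⟩ := h
  rfl

open Classical in
/-- The successor of a dart after the deletion of `x` from a trail. -/
theorem liftHalf_formPerm_deleteEdge {x : C.E} {l : List (C.E × Bool)}
    (hl : (l.map Prod.fst).Nodup) {d : {e : C.E // e ≠ x} × Bool} (hd : liftHalf d ∈ l) :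
    liftHalf ((C.deleteEdge x l).formPerm d) =
      if (l.formPerm (liftHalf d)).1 = x then l.formPerm (l.formPerm (liftHalf d))
      else l.formPerm (liftHalf d) := by
  obtain ⟨s, t, rfl⟩ := List.append_of_mem hd
  have hd0 : (liftHalf d).1 ≠ x := d.1.2
  have hdd : ((⟨(liftHalf d).1, hd0⟩, (liftHalf d).2) : {e : C.E // e ≠ x} × Bool) = d := rfl
  have hrot : (s ++ liftHalf d :: t) ~r (liftHalf d :: (t ++ s)) := by
    simpa using List.isRotated_append (l := s) (l' := liftHalf d :: t)
  have hrot' : C.deleteEdge x (s ++ liftHalf d :: t) ~r C.deleteEdge x (liftHalf d :: (t ++ s)) := by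
    rw [← List.cons_append, deleteEdge_append, deleteEdge_append]
    exact List.isRotated_append
  have hnd' : (C.deleteEdge x (s ++ liftHalf d :: t)).Nodup :=
    ((hl.sublist (C.map_deleteEdge x _)).of_map _).of_map _
  rw [List.formPerm_eq_of_isRotated hnd' hrot', List.formPerm_eq_of_isRotated hl.of_map hrot]
  have hl' := (hrot.map Prod.fst).nodup_iff.1 hl
  have hnd := hrot'.nodup_iff.1 hnd'
  rw [deleteEdge_cons_of_ne hd0, hdd] at hnd ⊢
  generalize t ++ s = m at hl' hnd
  rcases m with _ | ⟨y, r⟩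
  · simp [deleteEdge, hd0]
  rw [List.formPerm_apply_head _ _ _ hl'.of_map]
  by_cases hy : y.1 = x
  · rw [if_pos hy]
    rw [deleteEdge_cons_of_eq hy] at hnd ⊢
    have hrot2 : (liftHalf d :: y :: r) ~r (y :: (r ++ [liftHalf d])) := by
      simpa using List.isRotated_append (l := [liftHalf d]) (l' := y :: r)
    rw [List.formPerm_eq_of_isRotated hl'.of_map hrot2]
    have hl2 := (hrot2.map Prod.fst).nodup_iff.1 hl'
    rcases r with _ | ⟨w, r⟩
    · rw [List.nil_append, List.formPerm_apply_head _ _ _ hl2.of_map]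
      simp [deleteEdge]
    · have hw : w.1 ≠ x := by
        rintro rfl
        simp [hy] at hl'
      rw [List.cons_append] at hl2 ⊢
      rw [List.formPerm_apply_head _ _ _ hl2.of_map]
      rw [deleteEdge_cons_of_ne hw] at hnd ⊢
      rw [List.formPerm_apply_head _ _ _ hnd]
      rfl
  · rw [if_neg hy]
    rw [deleteEdge_cons_of_ne hy] at hnd ⊢
    rw [List.formPerm_apply_head _ _ _ hnd]
    rfl

section Contract

variable {x : C.E} {hx : ¬ C.graph.IsLoop x}

open Classical in
theorem liftHalf_nextPerm {f : C.F} {d : (C.contract x hx).E × Bool}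
    (hd : d ∈ (C.contract x hx).face f) :
    (liftHalf ((C.contract x hx).nextPerm f d) : C.E × Bool) =
      if (C.nextPerm f (liftHalf d)).1 = x then C.nextPerm f (C.nextPerm f (liftHalf d))
      else C.nextPerm f (liftHalf d) := by
  have h := liftHalf_formPerm_deleteEdge (C.face_nodup f) (d := d) (C.mem_deleteEdge.1 hd)
  rw [← nextPerm_eq] at h
  rw [← h]
  exact congrArg (fun π : Equiv.Perm ({e : C.E // e ≠ x} × Bool) => (liftHalf (π d) : C.E × Bool))
    (nextPerm_eq (C := C.contract x hx) f)

/-- The flag of `C` from which a flag of a contraction comes. -/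
def liftFlag (p : (C.contract x hx).Flag) : C.Flag :=
  ⟨(p.1.1, liftHalf p.1.2), by
    obtain ⟨⟨f, h⟩, hp⟩ := p
    obtain ⟨d, hd, hde⟩ := List.mem_map.1 hp
    refine List.mem_map.2 ⟨liftHalf d, C.mem_deleteEdge.1 hd, ?_⟩
    exact congrArg Subtype.val hde⟩

open Classical in
theorem liftFlag_flip_of_mem (p : (C.contract x hx).Flag)
    (hp : p.1.2 ∈ (C.contract x hx).face p.1.1) :
    liftFlag ((C.contract x hx).linkGraph.flip p) =
      if (C.linkGraph.vert (C.linkGraph.flip (liftFlag p))).1 = x then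
        C.linkGraph.flip (flagSwap (C.linkGraph.flip (liftFlag p)))
      else C.linkGraph.flip (liftFlag p) := by
  obtain ⟨⟨f, h⟩, hh⟩ := p
  have hm : liftHalf h ∈ C.face f := C.mem_deleteEdge.1 hp
  have h1 : (liftHalf (flagFlip f h) : C.E × Bool)
      = halfFlip (liftHalf ((C.contract x hx).nextPerm f h)) := by
    rw [flagFlip_of_mem hp]; rfl
  rw [liftHalf_nextPerm hp] at h1
  have h2 := flagFlip_of_mem hm
  have h3 : C.linkGraph.vert (C.linkGraph.flip (liftFlag ⟨(f, h), hh⟩))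
      = halfFlip (C.nextPerm f (liftHalf h)) := h2
  refine Subtype.ext (Prod.ext ?_ ?_)
  · split_ifs <;> rfl
  · refine h1.trans ?_
    rw [h3]
    change _ = (ite ((C.nextPerm f (liftHalf h)).1 = x) _ _ : C.Flag).1.2
    split_ifs with hc
    · change _ = flagFlip (C := C) f (halfFlip (flagFlip (C := C) f (liftHalf (x := x) h)))
      rw [h2, Multigraph.halfFlip_halfFlip, flagFlip_of_mem (nextPerm_mem_iff.2 hm)]
    · exact h2.symm

theorem fst_ne_of_liftFlag (p : (C.contract x hx).Flag) : (C.linkGraph.vert (liftFlag p)).1 ≠ x :=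
  p.1.2.1.2

open Classical in
theorem liftFlag_flip (p : (C.contract x hx).Flag) :
    liftFlag ((C.contract x hx).linkGraph.flip p) =
      if (C.linkGraph.vert (C.linkGraph.flip (liftFlag p))).1 = x then
        C.linkGraph.flip (flagSwap (C.linkGraph.flip (liftFlag p)))
      else C.linkGraph.flip (liftFlag p) := by
  by_cases hp : p.1.2 ∈ (C.contract x hx).face p.1.1
  · exact liftFlag_flip_of_mem p hp
  set q := (C.contract x hx).linkGraph.flip p with hq
  have hqp : (C.contract x hx).linkGraph.flip q = p := HalfEdgeGraph.flip_flip _ _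
  have hqm : q.1.2 ∈ (C.contract x hx).face q.1.1 := by
    change flagFlip p.1.1 p.1.2 ∈ (C.contract x hx).face p.1.1
    rw [flagFlip_of_notMem hp]
    exact symm_nextPerm_mem ((mem_map_iff.1 p.2).resolve_left hp)
  have h := liftFlag_flip_of_mem q hqm
  rw [hqp] at h
  split_ifs at h with hc
  · have h1 : C.linkGraph.flip (liftFlag p) = flagSwap (C.linkGraph.flip (liftFlag q)) := by
      rw [h, HalfEdgeGraph.flip_flip]
    rw [h1, if_pos (by exact hc), flagSwap_flagSwap, HalfEdgeGraph.flip_flip]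
  · have h1 : C.linkGraph.flip (liftFlag p) = liftFlag q := by
      rw [h, HalfEdgeGraph.flip_flip]
    rw [h1, if_neg (fst_ne_of_liftFlag q)]

theorem fst_ne_iff {h : C.E × Bool} : h.1 ≠ x ↔ h ≠ (x, false) ∧ h ≠ (x, true) := by
  obtain ⟨e, i⟩ := h
  cases i <;> simp

theorem mem_range_liftHalf (h : C.E × Bool) :
    h ∈ Set.range (liftHalf (C := C) (x := x)) ↔ h ≠ (x, false) ∧ h ≠ (x, true) := by
  rw [← fst_ne_iff]
  constructor
  · rintro ⟨d, rfl⟩; exact d.1.2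
  · intro hne; exact ⟨(⟨h.1, hne⟩, h.2), rfl⟩

/-- The link graph at the new vertex of `C / x` is the vertex sum of the link graphs at the
endvertices of `x`. -/
def contractVertexSum (hC : C.LinkBiconnected) (x : C.E) (hx : ¬ C.graph.IsLoop x) :
    HalfEdgeGraph.VertexSum C.linkGraph C.graph.endpoint (C.contract x hx).linkGraph
      (C.contract x hx).graph.endpoint where
  a := (x, false)
  b := (x, true)
  ι := liftFlag
  j := liftHalf
  τ := flagSwap
  ι_injective p q h := by
    have h1 := congrArg (fun p : C.Flag => p.1.1) h
    have h2 := congrArg (fun p : C.Flag => p.1.2) h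
    exact Subtype.ext (Prod.ext h1 (liftHalf_injective h2))
  mem_range_ι p := by
    rw [← fst_ne_iff]
    constructor
    · rintro ⟨q, rfl⟩; exact fst_ne_of_liftFlag q
    · obtain ⟨⟨f, h⟩, hp⟩ := p
      intro hne
      obtain ⟨d, hd, hde⟩ := List.mem_map.1 hp
      have hd' : (⟨d.1, hde ▸ hne⟩, d.2) ∈ C.deleteEdge x (C.face f) := C.mem_deleteEdge.2 hd
      exact ⟨⟨(f, (⟨h.1, hne⟩, h.2)), List.mem_map.2 ⟨_, hd', Subtype.ext hde⟩⟩, rfl⟩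
  j_injective := liftHalf_injective
  mem_range_j := mem_range_liftHalf
  vert_ι _ := rfl
  τ_τ := flagSwap_flagSwap
  vert_τ_of_a p h := by
    change halfFlip p.1.2 = _
    rw [show p.1.2 = (x, false) from h]; rfl
  vert_τ_of_b p h := by
    change halfFlip p.1.2 = _
    rw [show p.1.2 = (x, true) from h]; rfl
  vert_flip_ne := hC.vert_flip_ne
  κ_flip := endpoint_flip
  κ_ne := hx
  flip_ι p ha hb := by
    rw [liftFlag_flip, if_neg (fst_ne_iff.2 ⟨ha, hb⟩)]
  flip_ι_merged p h := by
    have h' : (C.linkGraph.vert (C.linkGraph.flip (liftFlag p))).1 = x := by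
      rcases h with h | h <;> rw [h]
    rw [liftFlag_flip, if_pos h']
  κ'_eq_iff w w' := by
    have h : (C.contract x hx).graph.endpoint w = (C.contract x hx).graph.endpoint w' ↔ _ :=
      Quotient.eq (r := C.contractSetoid x)
    rw [h]
    change (_ ∨ _ ∧ _) ↔ _
    simp only [Bool.exists_bool, liftHalf, eq_comm]

theorem LinkBiconnected.contract (hC : C.LinkBiconnected) (x : C.E) (hx : ¬ C.graph.IsLoop x) :
    (C.contract x hx).LinkBiconnected where
  vert_flip_ne := (contractVertexSum hC x hx).vert_flip_ne'
  biconnected := (contractVertexSum hC x hx).biconnected hC.biconnected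

end Contract

end TwoComplex

namespace TwoComplex

variable {C : TwoComplex.{u}}

/-! ### Rotation systems of link graphs -/

/-- The half-edges of the link graph at `a`, as half-edges of the union of all link graphs. -/
noncomputable def flagOf {a : C.V} (k : C.LinkEdge a × Bool) : C.Flag :=
  ⟨(k.1.1.1, ((C.link a).endpoint k).1), by
    obtain ⟨⟨⟨f, d⟩, hd, ha⟩, i⟩ := k
    cases i
    · exact mem_map_iff.2 (Or.inl hd)
    · refine mem_map_iff.2 (Or.inr ?_)
      change halfFlip (halfFlip (C.nextPerm f d)) ∈ C.face f
      rw [Multigraph.halfFlip_halfFlip]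
      exact nextPerm_mem_iff.2 hd⟩

theorem vert_flagOf {a : C.V} (k : C.LinkEdge a × Bool) :
    C.linkGraph.vert (flagOf k) = ((C.link a).endpoint k).1 := rfl

theorem endpoint_flagOf {a : C.V} (k : C.LinkEdge a × Bool) :
    C.graph.endpoint (C.linkGraph.vert (flagOf k)) = a := ((C.link a).endpoint k).2

theorem flagOf_true {a : C.V} (t : C.LinkEdge a) :
    flagOf (t, true) = C.linkGraph.flip (flagOf (t, false)) :=
  Subtype.ext (Prod.ext rfl (flagFlip_of_mem t.2.1).symm)

theorem flagOf_halfFlip {a : C.V} (k : C.LinkEdge a × Bool) :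
    flagOf (halfFlip k) = C.linkGraph.flip (flagOf k) := by
  obtain ⟨t, i⟩ := k
  cases i
  · exact flagOf_true t
  · change flagOf (t, false) = _
    rw [flagOf_true, HalfEdgeGraph.flip_flip]

theorem flagOf_injective {a : C.V} : Function.Injective (flagOf (C := C) (a := a)) := by
  have h1 : ∀ t t' : C.LinkEdge a, flagOf (t, false) = flagOf (t', false) → t = t' := by
    intro t t' h
    have := congrArg Subtype.val h
    exact Subtype.ext this
  have h2 : ∀ t t' : C.LinkEdge a, flagOf (t, false) ≠ flagOf (t', true) := by
    intro t t' h
    have e1 : t.1.1 = t'.1.1 := congrArg (fun p : C.Flag => p.1.1) h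
    have e2 : t.1.2 = halfFlip (C.nextPerm t'.1.1 t'.1.2) := congrArg (fun p : C.Flag => p.1.2) h
    have h3 := halfFlip_notMem (nextPerm_mem_iff.2 t'.2.1)
    rw [← e2, ← e1] at h3
    exact h3 t.2.1
  rintro ⟨t, i⟩ ⟨t', i'⟩ h
  cases i <;> cases i'
  · rw [h1 t t' h]
  · exact absurd h (h2 t t')
  · exact absurd h.symm (h2 t' t)
  · rw [flagOf_true, flagOf_true] at h
    rw [h1 t t' (Function.LeftInverse.injective C.linkGraph.flip_flip h)]

theorem exists_flagOf {a : C.V} {p : C.Flag} (hp : C.graph.endpoint (C.linkGraph.vert p) = a) :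
    ∃ k : C.LinkEdge a × Bool, flagOf k = p := by
  have key : ∀ p : C.Flag, p.1.2 ∈ C.face p.1.1 → C.graph.endpoint (C.linkGraph.vert p) = a →
      ∃ t : C.LinkEdge a, flagOf (t, false) = p := fun p hm hp => ⟨⟨p.1, hm, hp⟩, rfl⟩
  by_cases hm : p.1.2 ∈ C.face p.1.1
  · obtain ⟨t, ht⟩ := key p hm hp
    exact ⟨_, ht⟩
  · obtain ⟨t, ht⟩ := key (C.linkGraph.flip p) (by
      change flagFlip p.1.1 p.1.2 ∈ C.face p.1.1
      rw [flagFlip_of_notMem hm]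
      exact symm_nextPerm_mem ((mem_map_iff.1 p.2).resolve_left hm))
      ((endpoint_flip p).trans hp)
    exact ⟨(t, true), by rw [flagOf_true, ht, HalfEdgeGraph.flip_flip]⟩

theorem exists_flagOf_eq (p : C.Flag) : ∃ (a : C.V) (k : C.LinkEdge a × Bool), flagOf k = p :=
  ⟨_, exists_flagOf rfl⟩

theorem link_adj_iff {a : C.V} {c d : C.LinkVertex a} :
    (C.link a).Adj c d ↔ C.linkGraph.Adj c.1 d.1 := by
  constructor
  · rintro ⟨k, rfl, rfl⟩
    exact ⟨flagOf k, rfl, by rw [← flagOf_halfFlip]; rfl⟩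
  · rintro ⟨p, hp, hp'⟩
    obtain ⟨k, rfl⟩ := exists_flagOf (a := a) (p := p) (by rw [hp]; exact c.2)
    refine ⟨k, Subtype.ext hp, Subtype.ext ?_⟩
    rw [← hp', ← flagOf_halfFlip]
    rfl

theorem LocallyThreeConnected.linkBiconnected (hC : C.LocallyThreeConnected) :
    C.LinkBiconnected where
  vert_flip_ne p h := by
    obtain ⟨a, ⟨t, i⟩, rfl⟩ := exists_flagOf_eq p
    refine (hC _).not_isLoop t (Subtype.ext ?_)
    rw [← flagOf_halfFlip, vert_flagOf, vert_flagOf] at h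
    cases i
    · exact h.symm
    · exact h
  biconnected B hB c d hcd hc hd := by
    classical
    have := Fintype.ofFinite (C.LinkVertex (C.graph.endpoint c))
    have h := (hC (C.graph.endpoint c)).connected_delete {w | w.1 ∈ B} (by
        refine lt_of_le_of_lt (Finset.card_le_one.2 fun w hw w' hw' => ?_) (by norm_num)
        simp only [Finset.mem_filter, Finset.mem_univ, true_and] at hw hw'
        exact Subtype.ext (hB hw hw'))
      ⟨c, rfl⟩ ⟨d, hcd.symm⟩ (by simpa using hc) (by simpa using hd)
    exact Relation.ReflTransGen.lift Subtype.val
      (fun _ _ h => ⟨link_adj_iff.1 h.1, by simpa using h.2⟩) _ _ h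

theorem LinkBiconnected.link_connected (hC : C.LinkBiconnected) {a : C.V}
    (c d : C.LinkVertex a) : Relation.ReflTransGen (C.link a).Adj c d := by
  have h := hC.biconnected ∅ Set.subsingleton_empty c.1 d.1 (c.2.trans d.2.symm) (by simp)
    (by simp)
  suffices ∀ w, Relation.ReflTransGen
      (fun c d => C.linkGraph.Adj c d ∧ c ∉ (∅ : Set _) ∧ d ∉ (∅ : Set _)) c.1 w →
      ∃ hw : C.graph.endpoint w = a, Relation.ReflTransGen (C.link a).Adj c ⟨w, hw⟩ from
    (this _ h).2
  intro w h
  induction h with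
  | refl => exact ⟨c.2, .refl⟩
  | @tail v w _ h ih =>
    obtain ⟨hv, ih⟩ := ih
    have hw : C.graph.endpoint w = a := by
      obtain ⟨p, rfl, rfl⟩ := h.1
      rw [endpoint_flip, hv]
    exact ⟨hw, ih.tail (link_adj_iff.2 h.1)⟩

/-- The half-edges of the link graph at `a` are the half-edges of the union of all link graphs that
belong to this link graph. -/
noncomputable def flagEquiv (a : C.V) :
    C.LinkEdge a × Bool ≃ {p : C.Flag // C.graph.endpoint (C.linkGraph.vert p) = a} :=
  Equiv.ofBijective (fun k => ⟨flagOf k, endpoint_flagOf k⟩)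
    ⟨fun _ _ h => flagOf_injective (congrArg Subtype.val h), fun p => by
      obtain ⟨k, hk⟩ := exists_flagOf p.2
      exact ⟨k, Subtype.ext hk⟩⟩

/-- The rotation system `R` of the link graph at `a` is the restriction of the permutation `σ`. -/
def IsRestriction (σ : Equiv.Perm C.Flag) {a : C.V} (R : (C.link a).RotationSystem) : Prop :=
  ∀ k, flagOf (R.next k) = σ (flagOf k)

theorem sameCycle_flagOf {σ : Equiv.Perm C.Flag} {a : C.V}
    {f : Equiv.Perm (C.LinkEdge a × Bool)} (h : ∀ k, flagOf (f k) = σ (flagOf k))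
    (k m : C.LinkEdge a × Bool) :
    σ.SameCycle (flagOf k) (flagOf m) ↔ f.SameCycle k m := by
  refine ⟨fun hs => ?_, fun hs => hs.of_semiconj fun k => (h k).symm⟩
  obtain ⟨n, hn⟩ := hs.exists_nat_pow_eq
  refine ⟨n, flagOf_injective ?_⟩
  rw [← hn, zpow_natCast]
  clear hn
  induction n with
  | zero => rfl
  | succ n ih => rw [pow_succ', pow_succ', Equiv.Perm.mul_apply, Equiv.Perm.mul_apply, h, ih]

theorem exists_isRestriction {σ : Equiv.Perm C.Flag} (hσ : C.linkGraph.IsRotation σ) (a : C.V) :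
    ∃ R : (C.link a).RotationSystem, IsRestriction σ R := by
  let τ : Equiv.Perm {p : C.Flag // C.graph.endpoint (C.linkGraph.vert p) = a} :=
    σ.subtypePerm fun p => by rw [hσ.vert_apply]
  have h : ∀ k : C.LinkEdge a × Bool,
      flagOf (((flagEquiv a).trans τ).trans (flagEquiv a).symm k) = σ (flagOf k) := by
    intro k
    have := (flagEquiv a).apply_symm_apply (τ (flagEquiv a k))
    exact congrArg Subtype.val this
  refine ⟨⟨((flagEquiv a).trans τ).trans (flagEquiv a).symm, fun k m => ?_⟩, h⟩
  rw [← sameCycle_flagOf h, hσ, vert_flagOf, vert_flagOf, Subtype.ext_iff]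

theorem exists_rotation (R : ∀ a, (C.link a).RotationSystem) :
    ∃ σ : Equiv.Perm C.Flag, C.linkGraph.IsRotation σ ∧ ∀ a, IsRestriction σ (R a) := by
  let e : (Σ a, C.LinkEdge a × Bool) ≃ C.Flag :=
    (Equiv.sigmaCongrRight flagEquiv).trans
      (Equiv.sigmaFiberEquiv fun p : C.Flag => C.graph.endpoint (C.linkGraph.vert p))
  have he : ∀ a k, e ⟨a, k⟩ = flagOf k := fun a k => rfl
  let σ : Equiv.Perm C.Flag :=
    (e.symm.trans (Equiv.sigmaCongrRight fun a => (R a).next)).trans e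
  have hσ : ∀ a, IsRestriction σ (R a) := by
    intro a k
    change _ = e (Equiv.sigmaCongrRight (fun a => (R a).next) (e.symm (flagOf k)))
    rw [← he, ← he a k, Equiv.symm_apply_apply]
    rfl
  refine ⟨σ, fun p q => ?_, hσ⟩
  obtain ⟨a, k, rfl⟩ := exists_flagOf_eq p
  have hv : ∀ p, C.graph.endpoint (C.linkGraph.vert (σ p))
      = C.graph.endpoint (C.linkGraph.vert p) := by
    intro p
    obtain ⟨b, k, rfl⟩ := exists_flagOf_eq p
    rw [← hσ b k, endpoint_flagOf, endpoint_flagOf]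
  have hend : σ.SameCycle (flagOf k) q ∨ C.linkGraph.vert (flagOf k) = C.linkGraph.vert q →
      C.graph.endpoint (C.linkGraph.vert q) = a := by
    rintro (h | h)
    · obtain ⟨n, rfl⟩ := h.exists_nat_pow_eq
      clear h
      induction n with
      | zero => exact endpoint_flagOf k
      | succ n ih => rw [pow_succ', Equiv.Perm.mul_apply, hv, ih]
    · rw [← h, endpoint_flagOf]
  by_cases hq : C.graph.endpoint (C.linkGraph.vert q) = a
  · obtain ⟨m, rfl⟩ := exists_flagOf hq
    rw [sameCycle_flagOf (hσ _), (R _).sameCycle_iff, vert_flagOf, vert_flagOf, Subtype.ext_iff]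
  · exact ⟨fun h => absurd (hend (Or.inl h)) hq, fun h => absurd (hend (Or.inr h)) hq⟩

end TwoComplex

/-! ### Planar rotation systems of 2-complexes and contractions -/

namespace TwoComplex

variable {C : TwoComplex.{u}}

/-- The rotation systems of all link graphs are planar if and only if the surface of their union
has trivial first homology. -/
theorem planar_iff_homologyTrivial (hC : C.LinkBiconnected) {σ : Equiv.Perm C.Flag}
    {R : ∀ a, (C.link a).RotationSystem} (hR : ∀ a, IsRestriction σ (R a)) :
    (∀ a, (R a).Planar) ↔ C.linkGraph.HomologyTrivial σ := by
  have hp : ∀ a, (R a).Planar ↔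
      (C.link a).toHalfEdgeGraph.HomologyTrivial (R a).next := fun a =>
    Multigraph.planar_iff_homologyTrivial hC.link_connected (R a)
  have hsum : ∀ (z : C.Flag → ZMod 2) (a : C.V) (w : C.LinkVertex a),
      fibreSum (C.link a).endpoint (fun k => z (flagOf k)) w
        = fibreSum C.linkGraph.vert z w.1 := by
    intro z a w
    refine fibreSum_comp _ _ flagOf flagOf_injective _ _ (fun k => ?_) (fun p hp => ?_) z
    · rw [vert_flagOf, Subtype.ext_iff]
    · exact exists_flagOf (by rw [hp]; exact w.2)
  constructor
  · intro h z hz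
    have hs : ∀ a, ∃ s : C.LinkEdge a × Bool → ZMod 2,
        (∀ k, s ((R a).next (halfFlip k)) = s k) ∧
        ∀ k, z (flagOf k) = s k + s (halfFlip k) := fun a =>
      (hp a).1 (h a) (fun k => z (flagOf k))
        ⟨fun k => (congrArg z (flagOf_halfFlip k)).trans (hz.flip _),
          fun w => (hsum z a w).trans (hz.sum _)⟩
    choose s hs1 hs2 using hs
    obtain ⟨t, ht⟩ : ∃ t : C.Flag → ZMod 2, ∀ (a : C.V) (k : C.LinkEdge a × Bool),
        t (flagOf k) = s a k := by
      choose a k hk using exists_flagOf_eq (C := C)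
      refine ⟨fun p => s (a p) (k p), fun b m => ?_⟩
      have : ∀ (b c : C.V) (m : C.LinkEdge b × Bool) (n : C.LinkEdge c × Bool),
          flagOf m = flagOf n → s b m = s c n := by
        intro b c m n h
        obtain rfl : b = c := by rw [← endpoint_flagOf m, h, endpoint_flagOf]
        rw [flagOf_injective h]
      exact this _ _ _ _ (hk (flagOf m))
    refine ⟨t, fun p => ?_, fun p => ?_⟩
    · obtain ⟨a, k, rfl⟩ := exists_flagOf_eq p
      rw [← flagOf_halfFlip, ← hR a, ht, ht, hs1]
    · obtain ⟨a, k, rfl⟩ := exists_flagOf_eq p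
      rw [← flagOf_halfFlip, ht, ht, hs2]
  · intro h a
    refine (hp a).2 fun z hz => ?_
    let y : C.Flag → ZMod 2 := Function.extend flagOf z 0
    have hy : ∀ k, y (flagOf k) = z k := fun k => flagOf_injective.extend_apply _ _ _
    have hy0 : ∀ p, C.graph.endpoint (C.linkGraph.vert p) ≠ a → y p = 0 := fun p hp =>
      Function.extend_apply' _ _ _ fun ⟨k, hk⟩ => hp (by rw [← hk, endpoint_flagOf])
    obtain ⟨s, hs1, hs2⟩ := h y ⟨fun p => by
        by_cases hpa : C.graph.endpoint (C.linkGraph.vert p) = a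
        · obtain ⟨k, rfl⟩ := exists_flagOf hpa
          rw [← flagOf_halfFlip, hy, hy]
          exact hz.flip k
        · rw [hy0 p hpa, hy0 _ (by rwa [endpoint_flip])], fun w => by
        by_cases hw : C.graph.endpoint w = a
        · rw [← hsum y a ⟨w, hw⟩, ← hz.sum ⟨w, hw⟩]
          exact fibreSum_congr _ _ _ _ fun k _ => hy k
        · exact fibreSum_eq_zero _ _ _ fun p hp => hy0 p (by rwa [hp])⟩
    refine ⟨fun k => s (flagOf k), fun k => ?_, fun k => ?_⟩
    · exact (congrArg s ((hR a _).trans (congrArg σ (flagOf_halfFlip k)))).trans (hs1 _)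
    · exact (hy k).symm.trans ((hs2 _).trans (by rw [← flagOf_halfFlip]; rfl))

/-- The rotators at the two halves of each edge are reverse to each other, that is, exchanging the
halves conjugates `σ` to its inverse. -/
def IsReversing (σ : Equiv.Perm C.Flag) : Prop :=
  ∀ p, σ (flagSwap (σ p)) = flagSwap p

/-- A planar rotation system of `C`, as a permutation of the half-edges of the union of all link
graphs. -/
structure IsPlanarRotation (σ : Equiv.Perm C.Flag) : Prop where
  isRotation : C.linkGraph.IsRotation σ
  isReversing : IsReversing σ
  homologyTrivial : C.linkGraph.HomologyTrivial σ

theorem flag_ext {p q : C.Flag} (h1 : p.1.1 = q.1.1)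
    (h2 : C.linkGraph.vert p = C.linkGraph.vert q) : p = q :=
  Subtype.ext (Prod.ext h1 h2)

/-- The flag of the face `f` at the half-edge `(e, i)`. -/
def flagAt {e : C.E} (f : C.IncidentFace e) (i : Bool) : C.Flag := ⟨(f.1, (e, i)), f.2⟩

theorem flagSwap_flagAt {e : C.E} (f : C.IncidentFace e) (i : Bool) :
    flagSwap (flagAt f i) = flagAt f (!i) := rfl

theorem IsPlanarRotation.locallyPlanar (hC : C.LinkBiconnected) {σ : Equiv.Perm C.Flag}
    (hσ : IsPlanarRotation σ) : C.LocallyPlanar := by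
  choose R hR using fun a => exists_isRestriction hσ.isRotation a
  intro a
  refine ⟨R a, (planar_iff_homologyTrivial hC hR).2 hσ.homologyTrivial a, ?_⟩
  intro e k m hk hm hkm
  have h1 : flagOf m = flagSwap (flagOf k) := by
    refine flag_ext hkm.symm ?_
    change ((C.link a).endpoint m).1 = halfFlip ((C.link a).endpoint k).1
    rw [hm, hk]; rfl
  have h2 : flagOf ((R a).next.symm m) = flagSwap (σ (flagOf k)) := by
    rw [← σ.injective.eq_iff, ← hR a, Equiv.apply_symm_apply, hσ.isReversing, h1]
  have h3 := congrArg (fun p : C.Flag => p.1.1) h2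
  have h4 := congrArg (fun p : C.Flag => p.1.1) (hR a k)
  exact h4.trans h3.symm

theorem exists_isPlanarRotation_of_planar (hC : C.LinkBiconnected) (S : C.RotationSystem)
    (hS : S.Planar) : ∃ σ : Equiv.Perm C.Flag, IsPlanarRotation σ := by
  choose R hR1 hR2 using hS
  obtain ⟨σ, hrot, hσ⟩ := exists_rotation R
  refine ⟨σ, hrot, ?_, (planar_iff_homologyTrivial hC hσ).1 hR2⟩
  have key : ∀ (e : C.E) (f : C.IncidentFace e),
      σ (flagAt f true) = flagAt (S.rot e f) true ∧
      σ (flagAt (S.rot e f) false) = flagAt f false := by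
    intro e f
    constructor
    · obtain ⟨a, k, hk⟩ := exists_flagOf_eq (flagAt f true)
      refine flag_ext ?_ (hrot.vert_apply _)
      rw [← hk, ← hσ a]
      exact (hR1 a e f _ k rfl).1 (congrArg (fun p : C.Flag => p.1.2) hk)
        (congrArg (fun p : C.Flag => p.1.1) hk)
    · obtain ⟨a, k, hk⟩ := exists_flagOf_eq (flagAt (S.rot e f) false)
      refine flag_ext ?_ (hrot.vert_apply _)
      rw [← hk, ← hσ a]
      exact (hR1 a e f _ k rfl).2 (congrArg (fun p : C.Flag => p.1.2) hk)
        (congrArg (fun p : C.Flag => p.1.1) hk)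
  rintro ⟨⟨f, e, i⟩, hf⟩
  change σ (flagSwap (σ (flagAt ⟨f, hf⟩ i))) = flagSwap (flagAt ⟨f, hf⟩ i)
  generalize (⟨f, hf⟩ : C.IncidentFace e) = f'
  cases i
  · obtain ⟨g, rfl⟩ := (S.rot e).surjective f'
    rw [(key e g).2, flagSwap_flagAt, flagSwap_flagAt]
    exact (key e g).1
  · rw [(key e f').1, flagSwap_flagAt, flagSwap_flagAt]
    exact (key e f').2

/-- If all edges are loops, loop-planarity of the link graphs makes their rotation systems fit
together. -/
theorem exists_isPlanarRotation_of_loops (hC : C.LinkBiconnected)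
    (hl : ∀ e, C.graph.IsLoop e) (h : C.LocallyPlanar) :
    ∃ σ : Equiv.Perm C.Flag, IsPlanarRotation σ := by
  choose R hR1 hR2 using h
  obtain ⟨σ, hrot, hσ⟩ := exists_rotation R
  refine ⟨σ, hrot, ?_, (planar_iff_homologyTrivial hC hσ).1 hR1⟩
  have key : ∀ (e : C.E) (f : C.IncidentFace e),
      σ (flagSwap (σ (flagAt f true))) = flagAt f false := by
    intro e f
    obtain ⟨a, k, hk⟩ := exists_flagOf_eq (flagAt f true)
    have ha : C.graph.endpoint (e, true) = a := by rw [← endpoint_flagOf k, hk]; rfl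
    obtain ⟨m, hm⟩ := exists_flagOf (a := a) (p := flagAt f false) ((hl e).trans ha)
    have h1 := hR2 a e k m (congrArg (fun p : C.Flag => p.1.2) hk)
      (congrArg (fun p : C.Flag => p.1.2) hm)
      ((congrArg (fun p : C.Flag => p.1.1) hk).trans
        (congrArg (fun p : C.Flag => p.1.1) hm).symm)
    have h2 : flagSwap (σ (flagAt f true)) = flagOf ((R a).next.symm m) := by
      refine flag_ext ?_ ?_
      · have h5 := congrArg (fun p : C.Flag => p.1.1) (hσ a k)
        rw [hk] at h5
        exact h5.symm.trans h1
      · have h3 : C.linkGraph.vert (flagOf ((R a).next.symm m)) = (e, false) := by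
          rw [← hrot.vert_apply, ← hσ a, Equiv.apply_symm_apply, hm]; rfl
        have h4 : C.linkGraph.vert (σ (flagAt f true)) = (e, true) := hrot.vert_apply _
        rw [h3]
        change halfFlip (C.linkGraph.vert (σ (flagAt f true))) = _
        rw [h4]; rfl
    rw [h2, ← hσ a, Equiv.apply_symm_apply, hm]
  have hrev : ∀ p, (C.linkGraph.vert p).2 = true → σ (flagSwap (σ p)) = flagSwap p := by
    rintro ⟨⟨f, e, i⟩, hf⟩ hi
    obtain rfl : i = true := hi
    exact key e ⟨f, hf⟩
  intro p
  by_cases hi : (C.linkGraph.vert p).2 = true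
  · exact hrev p hi
  · -- apply the identity to the predecessor `q` of `flagSwap p`
    obtain ⟨q, hq⟩ := σ.surjective (flagSwap p)
    have hqi : (C.linkGraph.vert q).2 = true := by
      rw [← hrot.vert_apply, hq]
      change (!(C.linkGraph.vert p).2) = true
      simpa using hi
    have h1 := hrev q hqi
    rw [hq, flagSwap_flagSwap] at h1
    rw [h1, flagSwap_flagSwap, hq]

/-- A planar rotation system of `C`, given as a permutation of flags, comes from one that is given
by the rotators of the edges. -/
theorem IsPlanarRotation.exists_planar (hC : C.LinkBiconnected) {σ : Equiv.Perm C.Flag}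
    (hσ : IsPlanarRotation σ) : ∃ S : C.RotationSystem, S.Planar := by
  choose R hR using fun a => exists_isRestriction hσ.isRotation a
  let φ : ∀ e, C.IncidentFace e ≃ {p : C.Flag // C.linkGraph.vert p = (e, true)} := fun e =>
    { toFun := fun f => ⟨flagAt f true, rfl⟩
      invFun := fun p => ⟨p.1.1.1, by
        have h := p.1.2
        rw [show p.1.1.2 = (e, true) from p.2] at h
        exact h⟩
      left_inv := fun f => rfl
      right_inv := fun p => Subtype.ext (flag_ext rfl p.2.symm) }
  let τ : ∀ e, Equiv.Perm {p : C.Flag // C.linkGraph.vert p = (e, true)} := fun e =>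
    σ.subtypePerm fun p => by rw [hσ.isRotation.vert_apply]
  let rot : ∀ e, Equiv.Perm (C.IncidentFace e) := fun e => ((φ e).trans (τ e)).trans (φ e).symm
  have hrot : ∀ e f, σ (flagAt f true) = flagAt (rot e f) true := by
    intro e f
    have h := (φ e).apply_symm_apply (τ e (φ e f))
    exact (congrArg Subtype.val h).symm
  refine ⟨⟨rot, fun e f g => ?_⟩, fun a => ⟨R a, ?_, ?_⟩⟩
  · have h : σ.SameCycle (flagAt f true) (flagAt g true) := (hσ.isRotation _ _).2 rfl
    obtain ⟨n, hn⟩ := h.exists_nat_pow_eq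
    refine ⟨n, ?_⟩
    have hpow : ∀ n : ℕ, (σ ^ n) (flagAt f true) = flagAt ((rot e ^ n) f) true := by
      intro n
      induction n with
      | zero => rfl
      | succ n ih =>
        rw [pow_succ', pow_succ', Equiv.Perm.mul_apply, Equiv.Perm.mul_apply, ih, hrot]
    rw [hpow] at hn
    exact Subtype.ext (congrArg (fun p : C.Flag => p.1.1) hn)
  · rintro e f g k (hfg : rot e f = g)
    have h1 := hrot e f
    rw [hfg] at h1
    refine ⟨fun hk hkf => ?_, fun hk hkg => ?_⟩
    · have hk' : flagOf k = flagAt f true := flag_ext hkf hk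
      have h2 := hR a k
      rw [hk', h1] at h2
      exact congrArg (fun p : C.Flag => p.1.1) h2
    · have hk' : flagOf k = flagAt g false := flag_ext hkg hk
      have h2 := hσ.isReversing (flagAt f true)
      rw [h1, flagSwap_flagAt, flagSwap_flagAt] at h2
      have h3 := hR a k
      rw [hk'] at h3
      exact congrArg (fun p : C.Flag => p.1.1) (h3.trans h2)
  · exact (planar_iff_homologyTrivial hC hR).2 hσ.homologyTrivial a

/-- Contracting a non-loop edge does not change whether there is a planar rotation system. -/
theorem exists_isPlanarRotation_contract_iff (hC : C.LinkBiconnected) (x : C.E)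
    (hx : ¬ C.graph.IsLoop x) :
    (∃ σ : Equiv.Perm (C.contract x hx).Flag, IsPlanarRotation σ) ↔
      ∃ σ : Equiv.Perm C.Flag, IsPlanarRotation σ := by
  set A := contractVertexSum hC x hx with hA
  have hswap : ∀ p, A.ι (flagSwap p) = flagSwap (A.ι p) := fun p => rfl
  constructor
  · rintro ⟨σ', h⟩
    obtain ⟨σ, h1, h2, h3, h4⟩ :=
      A.exists_rotation_of_homologyTrivial hC.biconnected h.isRotation h.homologyTrivial
    refine ⟨σ, h1, fun p => ?_, h2⟩
    by_cases hp : A.IsDeleted p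
    · exact h4 p hp
    · obtain ⟨p, rfl⟩ := A.exists_ι hp
      rw [h3, ← hswap, h3, h.isReversing, hswap]
  · rintro ⟨σ, h⟩
    have hι : ∀ p, ∃ q, A.ι q = σ (A.ι p) := fun p => A.exists_ι (by
      rw [HalfEdgeGraph.VertexSum.IsDeleted, h.isRotation.vert_apply]
      exact A.not_isDeleted_ι p)
    choose f hf using hι
    have hinj : Function.Injective f := fun p q hpq =>
      A.ι_injective (σ.injective (by rw [← hf, ← hf, hpq]))
    let σ' : Equiv.Perm (C.contract x hx).Flag :=
      Equiv.ofBijective f (Finite.injective_iff_bijective.1 hinj)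
    have hσ' : ∀ p, A.ι (σ' p) = σ (A.ι p) := hf
    refine ⟨σ', fun p q => ?_, fun p => A.ι_injective ?_,
      A.homologyTrivial_of_homologyTrivial h.isRotation (fun q _ => h.isReversing q) hσ'
        h.homologyTrivial⟩
    · have h1 : (C.contract x hx).linkGraph.vert p = (C.contract x hx).linkGraph.vert q ↔
          C.linkGraph.vert (A.ι p) = C.linkGraph.vert (A.ι q) := by
        rw [A.vert_ι, A.vert_ι, A.j_injective.eq_iff]
      rw [h1, ← h.isRotation]
      refine ⟨fun hs => hs.of_semiconj fun p => (hσ' p).symm, fun hs => ?_⟩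
      obtain ⟨n, hn⟩ := hs.exists_nat_pow_eq
      refine ⟨n, A.ι_injective ?_⟩
      rw [← hn, zpow_natCast]
      clear hn
      induction n with
      | zero => rfl
      | succ n ih =>
        rw [pow_succ', pow_succ', Equiv.Perm.mul_apply, Equiv.Perm.mul_apply, hσ', ih]
    · rw [hσ', hswap, hσ', h.isReversing, hswap]

theorem IsContraction.linkBiconnected {D : TwoComplex.{u}} (h : C.IsContraction D)
    (hC : C.LinkBiconnected) : D.LinkBiconnected := by
  induction h with
  | refl => exact hC
  | step D x hx _ ih => exact ih.contract x hx

theorem IsContraction.exists_isPlanarRotation {D : TwoComplex.{u}} (h : C.IsContraction D)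
    (hC : C.LinkBiconnected) (hσ : ∃ σ : Equiv.Perm C.Flag, IsPlanarRotation σ) :
    ∃ σ : Equiv.Perm D.Flag, IsPlanarRotation σ := by
  induction h with
  | refl => exact hσ
  | step D x hx h ih =>
    exact (exists_isPlanarRotation_contract_iff (h.linkBiconnected hC) x hx).2 ih

/-- Contract edges until all edges are loops, and lift the rotation system from there. -/
theorem exists_isPlanarRotation_of_contractions (hC : C.LinkBiconnected)
    (h : ∀ D : TwoComplex.{u}, C.IsContraction D → D.LocallyPlanar) (n : ℕ) :
    ∀ D : TwoComplex.{u}, C.IsContraction D → Nat.card D.E = n →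
      ∃ σ : Equiv.Perm D.Flag, IsPlanarRotation σ := by
  induction n with
  | zero =>
    intro D hD hn
    have : IsEmpty D.E := (Nat.card_eq_zero.1 hn).resolve_right fun h => h.not_finite D.finite_E
    exact exists_isPlanarRotation_of_loops (hD.linkBiconnected hC) (fun e => isEmptyElim e) (h D hD)
  | succ n ih =>
    intro D hD hn
    by_cases hl : ∀ e, D.graph.IsLoop e
    · exact exists_isPlanarRotation_of_loops (hD.linkBiconnected hC) hl (h D hD)
    · push Not at hl
      obtain ⟨x, hx⟩ := hl
      refine (exists_isPlanarRotation_contract_iff (hD.linkBiconnected hC) x hx).1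
        (ih _ (.step D x hx hD) ?_)
      classical
      have := Fintype.ofFinite D.E
      change Nat.card {e : D.E // e ≠ x} = n
      rw [Nat.card_eq_fintype_card] at hn ⊢
      rw [Fintype.card_subtype_compl, Fintype.card_subtype_eq, hn, Nat.add_sub_cancel]

end TwoComplex

theorem lemma2p3 (C : TwoComplex.{u}) (hC : C.LocallyThreeConnected) :
    (∃ S : C.RotationSystem, S.Planar) ↔
      ∀ D : TwoComplex.{u}, C.IsContraction D → D.LocallyPlanar := by
  have hC' := hC.linkBiconnected
  constructor
  · rintro ⟨S, hS⟩ D hD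
    obtain ⟨σ, hσ⟩ := hD.exists_isPlanarRotation hC'
      (TwoComplex.exists_isPlanarRotation_of_planar hC' S hS)
    exact hσ.locallyPlanar (hD.linkBiconnected hC')
  · intro h
    obtain ⟨σ, hσ⟩ := TwoComplex.exists_isPlanarRotation_of_contractions hC' h _ C .refl rfl
    exact hσ.exists_planar hC'
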